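/- Setting. Let $\mathbb E_1,\dots,\mathbb E_m$ be finite-dimensional real inner product spaces, $\mathbb E=\prod_i\mathbb E_i$, and $\bar{\mathbb R}=(-\infty,+\infty]$. Let $\mathcal X_i\subset\mathbb E_i$ be closed and convex, $\mathcal X=\prod_i\mathcal X_i$, let $f:\mathbb E\to\mathbb R$ be continuously differentiable, let $g_i:\mathbb E_i\to\bar{\mathbb R}$ be proper and lower semicontinuous with $\mathcal X_i\cap\operatorname{dom}g_i\neq\emptyset$, and put $$F(x)=f(x)+\sum_{i=1}^m g_i(x_i),\qquad \Phi(x)=F(x)+\sum_{i=1}^m I_{\mathcal X_i}(x_i),$$ where $I_{\mathcal X_i}$ is $0$ on $\mathcal X_i$ and $+\infty$ elsewhere. Assume that $F$ is bounded below on $\mathcal X$. A kernel on $\mathbb E_i$ is a proper, lower semicontinuous, convex function $\psi:\mathbb E_i\to\bar{\mathbb R}$ such that $C=\operatorname{int}\operatorname{dom}\psi$ is nonempty, $\operatorname{dom}\psi\subset\bar C$, $\operatorname{dom}\partial\psi=C$, and $\psi$ is continuously differentiable on $C$; $D_\psi(a,b)=\psi(a)-\psi(b)-\langle\nabla\psi(b),a-b\rangle$.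 A function $h$ that is continuously differentiable on $C$ is $(L,l)$-relative smooth to $\psi$ ($L>0$, $l\ge0$) if $-lD_\psi(a,b)\le h(a)-h(b)-\langle\nabla h(b),a-b\rangle\le LD_\psi(a,b)$ for all $a,b\in C$. Block relative smoothness. Let $\varphi_1,\dots,\varphi_m:\mathbb E\to\bar{\mathbb R}$ have a common domain, which meets $\mathcal X$. For all $i$ and all $y\in\operatorname{dom}\varphi_i$, the block function $\varphi_i(\cdot,y_{\neq i})$ is a kernel and $f(\cdot,y_{\neq i})$ is $(L_i^{y_{\neq i}},l_i^{y_{\neq i}})$-relative smooth to it, where the constants may depend on the blocks $y_j$, $j\ne i$. Surrogates. $u_i:\mathcal X_i\times\mathcal X_i\to\bar{\mathbb R}$ satisfies $u_i(y,y)=g_i(y)$ and $u_i(x,y)\ge g_i(x)$; it is convex and lower semicontinuous in its first variable and continuous in its second; and for each $y\in\mathcal X_i$ there is a function $\bar h$, continuously differentiable at $y$ with $\nabla\bar h(y)=0$, such that $u_i(x,y)\le g_i(x)+\bar h(x)$ for all $x\in\mathcal X_i$. Algorithm (BMME). Let $\delta_i\in(0,1)$ and $x^{-1},x^0\in\operatorname{int}\operatorname{dom}\varphi_i$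 for all $i$, with $x^0\in\mathcal X$. Write $x^{k,i-1}=(x_1^{k+1},\dots,x_{i-1}^{k+1},x_i^k,\dots,x_m^k)$, $\varphi_i^k=\varphi_i(\cdot,x^{k,i-1}_{\neq i})$, and let $L_i^k,l_i^k$ be the constants at $x^{k,i-1}_{\neq i}$ (for $k\ge-1$). For $k=0,1,\dots$ and $i=1,\dots,m$, a point $\bar x_i^k=x_i^k+\beta_i^k(x_i^k-x_i^{k-1})\in\operatorname{int}\operatorname{dom}\varphi_i^k$ is chosen with $$D_{\varphi_i^k}(x_i^k,\bar x_i^k)\le\frac{\delta_iL_i^{k-1}}{L_i^k+l_i^k}D_{\varphi_i^{k-1}}(x_i^{k-1},x_i^k),$$ and $$x_i^{k+1}\in\operatorname*{argmin}_{t\in\mathcal X_i}\Big\{L_i^kD_{\varphi_i^k}(t,\bar x_i^k)+\langle\nabla_if(\bar x_i^k,x^{k,i-1}_{\neq i}),t\rangle+u_i(t,x_i^k)\Big\},$$ the minimal value being finite. Assume $x^k\in\operatorname{int}\operatorname{dom}\varphi_i$ for all $k$ and $i$. Here the limiting subdifferential $\partial h$ consists of the limits of Fréchet subgradients along sequences $z^k\to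 x$ with $h(z^k)\to h(x)$; $x$ is a critical point of $h$ if $h(x)<+\infty$ and $0\in\partial h(x)$. $h$ has the Kurdyka–Łojasiewicz (KL) property at $\bar x\in\operatorname{dom}\partial h$ if there are $\eta\in(0,+\infty]$, a neighbourhood $U$ of $\bar x$ and a concave $\xi:[0,\eta)\to\mathbb R_+$, continuous at $0$ and $C^1$ on $(0,\eta)$, with $\xi(0)=0$ and $\xi'>0$, such that $\xi'(h(x)-h(\bar x))\operatorname{dist}(0,\partial h(x))\ge1$ whenever $x\in U$ and $h(\bar x)<h(x)<h(\bar x)+\eta$. **Theorem.** Assume in addition: 1. there are $N$ and $\underline L_i,\bar L_i>0$ with $\delta_i<\underline L_i/\bar L_i$ and $\underline L_i\le L_i^k\le\bar L_i$ for all $k\ge N$ and all $i$, and there is $\rho>0$ such that $\varphi_i^k$ is $\rho$-strongly convex for all $k\ge N$ and all $i$; 2. $\nabla f$ and all $\nabla\varphi_i$ are defined and Lipschitz continuous on every bounded subset of $\mathbb E$; 3. $\{x^k\}$ is bounded; 4. for each $i$ and each bounded $B\subset\mathcal X_i$ there is a constant $A_i$ such that, for all $x_i,y_i\in B$ and all $s_i\in\partial\big(I_{\mathcal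 X_i}+u_i(\cdot,y_i)\big)(x_i)$, there is $\xi_i\in\partial(I_{\mathcal X_i}+g_i)(x_i)$ with $\|\xi_i-s_i\|\le A_i\|x_i-y_i\|$; 5. $\Phi$ has the KL property at every point of $\operatorname{dom}\partial\Phi$. Then the whole sequence $\{x^k\}$ converges to a critical point of $\Phi$. -/

import Mathlib

open Filter Topology

noncomputable section

/-! Extended-real valued functions; the codomain `(-∞, +∞]` is `EReal` together with `h x ≠ ⊥`. -/

namespace BMME

/-- Effective domain of an extended-real valued function. -/
def dom {V : Type*} (h : V → EReal) : Set V := {x | h x ≠ ⊤}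

/-- The real values of `h` (meaningful on `dom h`). -/
def re {V : Type*} (h : V → EReal) : V → ℝ := fun x => (h x).toReal

/-- `h + I_S`, where `I_S` is the indicator function of `S` (`0` on `S`, `+∞` off `S`). -/
def addIndicator {V : Type*} (S : Set V) (h : V → EReal) : V → EReal :=
  open Classical in fun x => if x ∈ S then h x else ⊤

section OneSpace

variable {V : Type*} [NormedAddCommGroup V] [InnerProductSpace ℝ V]

/-- Fréchet subdifferential: `h x` is finite and
`liminf_{y → x, y ≠ x} (h y - h x - ⟪v, y - x⟫) / ‖y - x‖ ≥ 0`, written with `ε`. -/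
def frechetSubdiff (h : V → EReal) (x : V) : Set V :=
  {v | h x ≠ ⊤ ∧ h x ≠ ⊥ ∧ ∀ ε : ℝ, 0 < ε → ∀ᶠ y in 𝓝 x,
    h x + ((inner ℝ v (y - x) - ε * ‖y - x‖ : ℝ) : EReal) ≤ h y}

/-- Limiting subdifferential. -/
def limSubdiff (h : V → EReal) (x : V) : Set V :=
  {v | h x ≠ ⊤ ∧ h x ≠ ⊥ ∧ ∃ (xs : ℕ → V) (vs : ℕ → V),
    Tendsto xs atTop (𝓝 x) ∧ Tendsto (fun k => h (xs k)) atTop (𝓝 (h x)) ∧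
    (∀ k, vs k ∈ frechetSubdiff h (xs k)) ∧ Tendsto vs atTop (𝓝 v)}

/-- Critical points of an extended-real valued function. -/
def IsCritical (h : V → EReal) (x : V) : Prop :=
  x ∈ dom h ∧ (0 : V) ∈ limSubdiff h x

/-- The Kurdyka–Łojasiewicz property of `h` at `xb`. The inequality
`ξ' (h x - h xb) * dist (0, ∂h x) ≥ 1` is written for every element of `∂h x`
(the distance to the empty set is `+∞`). -/
def KLAt (h : V → EReal) (xb : V) : Prop :=
  ∃ η : EReal, 0 < η ∧ ∃ U ∈ 𝓝 xb, ∃ ξ : ℝ → ℝ,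
    ConcaveOn ℝ {s : ℝ | 0 ≤ s ∧ (s : EReal) < η} ξ ∧
    (∀ s : ℝ, 0 ≤ s → (s : EReal) < η → 0 ≤ ξ s) ∧
    ContDiffOn ℝ 1 ξ {s : ℝ | 0 < s ∧ (s : EReal) < η} ∧
    ContinuousWithinAt ξ {s : ℝ | 0 ≤ s ∧ (s : EReal) < η} 0 ∧
    ξ 0 = 0 ∧
    (∀ s : ℝ, 0 < s → (s : EReal) < η → 0 < deriv ξ s) ∧
    ∀ x ∈ U, h xb < h x → h x < h xb + η →
      ∀ v ∈ limSubdiff h x, 1 ≤ deriv ξ (re h x - re h xb) * ‖v‖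

/-- `ψ` is a kernel generating distance associated with `C`. Its gradient is used through
`fderiv ℝ (re ψ) y w = ⟪∇ψ y, w⟫`. -/
structure IsKernel (C : Set V) (ψ : V → EReal) : Prop where
  nonempty : C.Nonempty
  convex : Convex ℝ C
  isOpen : IsOpen C
  ne_bot : ∀ x, ψ x ≠ ⊥
  proper : (dom ψ).Nonempty
  lsc : LowerSemicontinuous ψ
  convexOn : ConvexOn ℝ (dom ψ) (re ψ)
  dom_subset : dom ψ ⊆ closure C
  /-- the domain of the (convex) subdifferential is `C` -/
  dom_subdiff : {x | x ∈ dom ψ ∧ ∃ v : V, ∀ z,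
    ψ x + ((inner ℝ v (z - x) : ℝ) : EReal) ≤ ψ z} = C
  interior_dom : interior (dom ψ) = C
  contDiffOn : ContDiffOn ℝ 1 (re ψ) C

/-- Bregman divergence `D_ψ(x, y)`, for `x ∈ dom ψ` and `y ∈ int dom ψ`. -/
def bregman (ψ : V → EReal) (x y : V) : ℝ :=
  re ψ x - re ψ y - fderiv ℝ (re ψ) y (x - y)

/-- The real function `h` is `(L, l)`-relative smooth to the kernel `ψ`. -/
structure IsRelSmooth (L l : ℝ) (ψ : V → EReal) (h : V → ℝ) : Prop where
  L_pos : 0 < L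
  l_nonneg : 0 ≤ l
  lsc : LowerSemicontinuous h
  contDiffOn : ContDiffOn ℝ 1 h (interior (dom ψ))
  upper : ∀ x ∈ interior (dom ψ), ∀ y ∈ interior (dom ψ),
    h x - h y - fderiv ℝ h y (x - y) ≤ L * bregman ψ x y
  lower : ∀ x ∈ interior (dom ψ), ∀ y ∈ interior (dom ψ),
    -l * bregman ψ x y ≤ h x - h y - fderiv ℝ h y (x - y)

/-- `∇ψ` is (defined and) Lipschitz continuous on every bounded subset of the whole space `V`. -/
def LipschitzGradOnBounded (ψ : V → EReal) : Prop :=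
  ∀ B : Set V, Bornology.IsBounded B →
    (∀ x ∈ B, x ∈ interior (dom ψ) ∧ DifferentiableAt ℝ (re ψ) x) ∧
    ∃ K, LipschitzOnWith K (fderiv ℝ (re ψ)) B

/-- `u` is a surrogate function of `g` on `X`; only its values on `X × X` matter. -/
structure IsSurrogate (X : Set V) (g : V → EReal) (u : V → V → EReal) : Prop where
  diag : ∀ y ∈ X, u y y = g y
  major : ∀ x ∈ X, ∀ y ∈ X, g x ≤ u x y

/-- Conditions on the surrogate: convex and lower semicontinuous in the first variable,
continuous in the second one, and the approximation error `u(·, y) - g` is bounded above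
by a function with zero gradient at `y`. -/
structure SurrogateAssumption (X : Set V) (g : V → EReal) (u : V → V → EReal) : Prop where
  /-- convexity of `u(·, y)` on `X`, by its epigraph -/
  convex : ∀ y ∈ X, Convex ℝ {p : V × ℝ | p.1 ∈ X ∧ u p.1 y ≤ (p.2 : EReal)}
  lsc : ∀ y ∈ X, LowerSemicontinuousOn (fun x => u x y) X
  cont : ∀ x ∈ X, ContinuousOn (fun y => u x y) X
  error : ∀ y ∈ X, ∃ hbar : V → ℝ, ContDiffAt ℝ 1 hbar y ∧ fderiv ℝ hbar y = 0 ∧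
    ∀ x ∈ X, u x y ≤ g x + (hbar x : EReal)

/-- On every bounded subset of `X`, each subgradient of `I_X + u(·, y)` at `x` is within
`A * ‖x - y‖` of a subgradient of `I_X + g` at `x`. -/
def SubgradientsClose (X : Set V) (g : V → EReal) (u : V → V → EReal) : Prop :=
  ∀ B : Set V, B ⊆ X → Bornology.IsBounded B → ∃ A : ℝ, ∀ x ∈ B, ∀ y ∈ B,
    ∀ s ∈ limSubdiff (addIndicator X (fun z => u z y)) x,
      ∃ ξ ∈ limSubdiff (addIndicator X g) x, ‖ξ - s‖ ≤ A * ‖x - y‖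

end OneSpace

section Blocks

variable {m : ℕ} {E : Fin m → Type*} [∀ i, NormedAddCommGroup (E i)]

/-- `(t, y_{≠ i})`: the vector `y` with its `i`-th block replaced by `t`. -/
def upd (y : PiLp 2 E) (i : Fin m) (t : E i) : PiLp 2 E :=
  WithLp.toLp 2 (Function.update y.ofLp i t)

/-- The block function `h(·, y_{≠ i})`. -/
def block {β : Type*} (h : PiLp 2 E → β) (i : Fin m) (y : PiLp 2 E) : E i → β :=
  fun t => h (upd y i t)

/-- The feasible set `∏ X_i`. -/
def feasible (X : ∀ i, Set (E i)) : Set (PiLp 2 E) := {x | ∀ i, x i ∈ X i}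

/-- The objective `F(x) = f(x) + ∑ g_i(x_i)`. -/
def objective (f : PiLp 2 E → ℝ) (g : ∀ i, E i → EReal) : PiLp 2 E → EReal :=
  fun x => (f x : EReal) + ∑ i, g i (x i)

/-- `Φ(x) = F(x) + ∑ I_{X_i}(x_i)`. -/
def Phi (f : PiLp 2 E → ℝ) (g : ∀ i, E i → EReal) (X : ∀ i, Set (E i)) : PiLp 2 E → EReal :=
  addIndicator (feasible X) (objective f g)

/-- A sequence `x^{-1}, x^0, x^1, …` is stored as `x : ℕ → _` with `x n = x^{n-1}`.
`inter x n i` is the vector whose blocks `j < i` are those of `x (n+1)` and whose blocks `j ≥ i`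
are those of `x n`; at `n = k + 1` this is `x^{k,i-1}`, and at `n = 0` it is `x^{-1,i-1}`. -/
def inter (x : ℕ → PiLp 2 E) (n : ℕ) (i : Fin m) : PiLp 2 E :=
  WithLp.toLp 2 (fun j => if j < i then x (n + 1) j else x n j)

/-- The kernel `φ_i^k = φ_i(·, x^{k,i-1}_{≠ i})`, with `n = k + 1`. -/
def kern (φ : Fin m → PiLp 2 E → EReal) (x : ℕ → PiLp 2 E) (n : ℕ) (i : Fin m) : E i → EReal :=
  block (φ i) i (inter x n i)

variable [∀ i, InnerProductSpace ℝ (E i)]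

/-- Standing assumptions on the problem `min F(x)`, `x_i ∈ X_i`. -/
structure Problem (f : PiLp 2 E → ℝ) (g : ∀ i, E i → EReal) (X : ∀ i, Set (E i)) : Prop where
  f_contDiff : ContDiff ℝ 1 f
  X_closed : ∀ i, IsClosed (X i)
  X_convex : ∀ i, Convex ℝ (X i)
  g_ne_bot : ∀ i t, g i t ≠ ⊥
  g_lsc : ∀ i, LowerSemicontinuous (g i)
  X_inter_dom : ∀ i, (X i ∩ dom (g i)).Nonempty
  bddBelow : ∃ c : ℝ, ∀ x ∈ feasible X, (c : EReal) ≤ objective f g x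

/-- `f` is block relative smooth with respect to `(φ_1, …, φ_m)`, with constants
`L_i^{y_{≠ i}} = L i y` and `l_i^{y_{≠ i}} = l i y`, which do not depend on the block `y_i`;
the kernels have a common domain, which meets the feasible set. -/
structure IsBlockRelSmooth (f : PiLp 2 E → ℝ) (X : ∀ i, Set (E i))
    (φ : Fin m → PiLp 2 E → EReal) (L l : Fin m → PiLp 2 E → ℝ) : Prop where
  ne_bot : ∀ i y, φ i y ≠ ⊥
  dom_eq : ∀ i j, dom (φ i) = dom (φ j)
  dom_meets : ∀ i, (feasible X ∩ dom (φ i)).Nonempty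
  L_block : ∀ i y t, L i (upd y i t) = L i y
  l_block : ∀ i y t, l i (upd y i t) = l i y
  kernel : ∀ i, ∀ y ∈ dom (φ i),
    IsKernel (interior (dom (block (φ i) i y))) (block (φ i) i y)
  relSmooth : ∀ i, ∀ y ∈ dom (φ i),
    IsRelSmooth (L i y) (l i y) (block (φ i) i y) (block f i y)

/-- The extrapolation point `x̄_i^k = x_i^k + β_i^k (x_i^k - x_i^{k-1})`. -/
def xbar (β : ℕ → Fin m → ℝ) (x : ℕ → PiLp 2 E) (k : ℕ) (i : Fin m) : E i :=
  x (k + 1) i + β k i • (x (k + 1) i - x k i)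

/-- The smooth part `L_i^k D_{φ_i^k}(t, x̄_i^k) + ⟪∇_i f(x̄_i^k, x^{k,i-1}_{≠ i}), t⟫` of the
objective of the `i`-th subproblem at iteration `k`. -/
def smoothPart (f : PiLp 2 E → ℝ) (φ : Fin m → PiLp 2 E → EReal) (L : Fin m → PiLp 2 E → ℝ)
    (β : ℕ → Fin m → ℝ) (x : ℕ → PiLp 2 E) (k : ℕ) (i : Fin m) (t : E i) : ℝ :=
  L i (inter x (k + 1) i) * bregman (kern φ x (k + 1) i) t (xbar β x k i) +
    fderiv ℝ (block f i (inter x (k + 1) i)) (xbar β x k i) t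

/-- `x` (with `x n = x^{n-1}`) is generated by the algorithm with parameters `δ`, extrapolation
parameters `β_i^k = β k i` and surrogates `u`. The clauses at `k` describe iteration `k ≥ 0`. -/
structure IsSequence (f : PiLp 2 E → ℝ) (X : ∀ i, Set (E i))
    (φ : Fin m → PiLp 2 E → EReal) (L l : Fin m → PiLp 2 E → ℝ)
    (u : ∀ i, E i → E i → EReal) (δ : Fin m → ℝ) (β : ℕ → Fin m → ℝ)
    (x : ℕ → PiLp 2 E) : Prop where
  δ_mem : ∀ i, δ i ∈ Set.Ioo (0 : ℝ) 1
  /-- `x^{-1}` and `x^0` lie in the interior of the domain of the kernels -/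
  init : ∀ i, x 0 ∈ interior (dom (φ i)) ∧ x 1 ∈ interior (dom (φ i))
  /-- `x^0` is feasible -/
  init_feasible : x 1 ∈ feasible X
  xbar_mem : ∀ k i, xbar β x k i ∈ interior (dom (kern φ x (k + 1) i))
  extrapolation : ∀ k i,
    bregman (kern φ x (k + 1) i) (x (k + 1) i) (xbar β x k i) ≤
      δ i * L i (inter x k i) / (L i (inter x (k + 1) i) + l i (inter x (k + 1) i)) *
        bregman (kern φ x k i) (x k i) (x (k + 1) i)
  /-- `x_i^{k+1} ∈ X_i` is a point where the objective of the subproblem is finite … -/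
  update_mem : ∀ k i, x (k + 2) i ∈ X i ∧ x (k + 2) i ∈ dom (kern φ x (k + 1) i) ∧
    u i (x (k + 2) i) (x (k + 1) i) ≠ ⊤
  /-- … and it minimizes that objective over `X_i` (off the domain of the kernel it is `+∞`) -/
  update_min : ∀ k i, ∀ t ∈ X i, t ∈ dom (kern φ x (k + 1) i) →
    (smoothPart f φ L β x k i (x (k + 2) i) : EReal) + u i (x (k + 2) i) (x (k + 1) i) ≤
      (smoothPart f φ L β x k i t : EReal) + u i t (x (k + 1) i)

/-- From some iteration `N` on, the constants `L_i^k` stay in `[Lmin_i, Lmax_i]` with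
`δ_i < Lmin_i / Lmax_i`, and the kernels `φ_i^k` are strongly convex with a common modulus. -/
def EventualBounds (φ : Fin m → PiLp 2 E → EReal) (L : Fin m → PiLp 2 E → ℝ)
    (δ : Fin m → ℝ) (x : ℕ → PiLp 2 E) : Prop :=
  ∃ N : ℕ,
    (∃ Lmin Lmax : Fin m → ℝ, ∀ i, 0 < Lmin i ∧ 0 < Lmax i ∧ δ i < Lmin i / Lmax i ∧
      ∀ k, N ≤ k → Lmin i ≤ L i (inter x (k + 1) i) ∧ L i (inter x (k + 1) i) ≤ Lmax i) ∧
    ∃ ρ : ℝ, 0 < ρ ∧ ∀ i, ∀ k, N ≤ k →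
      StrongConvexOn (dom (kern φ x (k + 1) i)) ρ (re (kern φ x (k + 1) i))

end Blocks

end BMME

end

/-!
Since the gradients of the kernels are Lipschitz on bounded subsets of the whole space, the kernels
are finite and differentiable everywhere, and all estimates take place on one ball containing the
iterates and the extrapolated points.

*Descent.* Comparing the new block with the old one in the convex subproblem
(`le_of_isMin_add_convex`) and using both sides of relative smoothness, one update of block `i`
loses `L_i^k D(x_i^k, x_i^{k+1})` and gains at most `(L_i^k + l_i^k) D(x_i^k, x̄_i^k)`, which the
extrapolation condition bounds by `δ_i L_i^{k-1} D(x_i^{k-1}, x_i^k)`. So the objective itself need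
not decrease, but the objective plus these damped divergences does (`lyapunov`), by at least a
multiple of the squared step (`exists_tendsto_lyapunov`).

*Small subgradients.* The optimality conditions of the subproblems, the sum rule for limiting
subgradients (`gradient_add_mem_limSubdiff`) and the closeness of the subgradients of `u_i` and
`g_i` give elements of `∂Φ` at the iterates bounded by the last two steps
(`exists_limSubdiff_Phi_norm_le`). Along a convergent subsequence the values of `Φ` converge to the
value at the limit (`Phi_eq_of_tendsto`), so every cluster point is critical.

*Convergence.* The Kurdyka–Łojasiewicz inequality is assumed for `Φ` and not for the Lyapunov
function, which exceeds `Φ` by at most `c ‖x^k - x^{k-1}‖²`. Let `s` be the excess of the Lyapunov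
function over its limit. Either at least half of `s` comes from `Φ`, and the inequality applies with
`ξ (s / 2)`; or at least half of it comes from the squared step, and `√ s` does the same job without
any inequality. Hence `ξ (s / 2) + √ s` desingularizes the Lyapunov function along the sequence
(`step_le_of_KL`), and the usual trapping argument near a cluster point gives convergence
(`tendsto_of_step_le`, `tendsto_of_KL`).
-/

namespace BMME

/-! ### First-order estimates -/

section FirstOrder

variable {V : Type*} [NormedAddCommGroup V] [NormedSpace ℝ V]

/-- A linear lower bound on the increments of `q` along a ray, up to a quadratic error, bounds the
directional derivative from below. -/
theorem le_fderiv_of_forall_le {q : V → ℝ} {v d : V} (hq : DifferentiableAt ℝ q v) {c e : ℝ}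
    (h : ∀ r : ℝ, 0 < r → r < 1 → r * c ≤ q (v + r • d) - q v + r ^ 2 * e) :
    c ≤ fderiv ℝ q v d := by
  have hline : HasDerivAt (fun r : ℝ => v + r • d) d 0 := by
    simpa using ((hasDerivAt_id (0 : ℝ)).smul_const d).const_add v
  have hq' : HasFDerivAt q (fderiv ℝ q v) (v + (0 : ℝ) • d) := by
    simpa using hq.hasFDerivAt
  have hcomp : HasDerivAt (fun r : ℝ => q (v + r • d)) (fderiv ℝ q v d) 0 :=
    hq'.comp_hasDerivAt 0 hline
  have hslope : Tendsto (fun r : ℝ => r⁻¹ * (q (v + r • d) - q v) + r * e) (𝓝[>] 0)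
      (𝓝 (fderiv ℝ q v d)) := by
    have h1 := hcomp.tendsto_slope_zero_right
    have h2 : Tendsto (fun r : ℝ => r * e) (𝓝[>] 0) (𝓝 0) := by
      have : Tendsto (fun r : ℝ => r * e) (𝓝 0) (𝓝 (0 * e)) := by
        exact (continuous_id.mul continuous_const).tendsto 0
      rw [zero_mul] at this
      exact this.mono_left nhdsWithin_le_nhds
    simpa using h1.add h2
  refine ge_of_tendsto hslope ?_
  filter_upwards [Ioo_mem_nhdsGT (zero_lt_one' ℝ)] with r hr
  have h3 := h r hr.1 hr.2
  have h4 : r⁻¹ * (r * c) ≤ r⁻¹ * (q (v + r • d) - q v + r ^ 2 * e) :=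
    mul_le_mul_of_nonneg_left h3 (inv_nonneg.2 hr.1.le)
  have hr0 : r ≠ 0 := hr.1.ne'
  have h5 : r⁻¹ * (r * c) = c := by field_simp
  have h6 : r⁻¹ * (q (v + r • d) - q v + r ^ 2 * e) = r⁻¹ * (q (v + r • d) - q v) + r * e := by
    field_simp
  linarith

theorem strongConvexOn_le_bregman {q : V → ℝ} {ρ : ℝ} (hq : StrongConvexOn Set.univ ρ q)
    (a b : V) (hb : DifferentiableAt ℝ q b) :
    ρ / 2 * ‖a - b‖ ^ 2 ≤ q a - q b - fderiv ℝ q b (a - b) := by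
  have key : q b - q a + ρ / 2 * ‖a - b‖ ^ 2 ≤ fderiv ℝ (fun z => -q z) b (a - b) := by
    refine le_fderiv_of_forall_le (e := ρ / 2 * ‖a - b‖ ^ 2) hb.neg fun r h0 h1 => ?_
    have h := hq.2 (Set.mem_univ a) (Set.mem_univ b) h0.le (sub_nonneg.2 h1.le) (by ring)
    have hpt : r • a + (1 - r) • b = b + r • (a - b) := by module
    rw [hpt] at h
    simp only [smul_eq_mul] at h
    simp only [Pi.neg_apply]
    linarith
  rw [fderiv_fun_neg] at key
  have : (-fderiv ℝ q b) (a - b) = -(fderiv ℝ q b (a - b)) := rfl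
  linarith

theorem bregman_le_of_lipschitz {q : V → ℝ} {B : Set V} {K : ℝ} (hB : Convex ℝ B)
    (hdiff : ∀ z ∈ B, DifferentiableAt ℝ q z)
    (hK : ∀ z ∈ B, ∀ w ∈ B, ‖fderiv ℝ q z - fderiv ℝ q w‖ ≤ K * ‖z - w‖) (hK0 : 0 ≤ K)
    {a b : V} (ha : a ∈ B) (hb : b ∈ B) :
    q a - q b - fderiv ℝ q b (a - b) ≤ K * ‖a - b‖ ^ 2 := by
  have hseg : segment ℝ b a ⊆ B := hB.segment_subset hb ha
  have h := (convex_segment b a).norm_image_sub_le_of_norm_fderiv_le' (𝕜 := ℝ) (f := q)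
    (φ := fderiv ℝ q b) (C := K * ‖a - b‖) (fun z hz => hdiff z (hseg hz))
    (fun z hz => (hK z (hseg hz) b hb).trans
      (mul_le_mul_of_nonneg_left (norm_sub_le_of_mem_segment hz) hK0))
    (left_mem_segment ℝ b a) (right_mem_segment ℝ b a)
  have h2 := (le_abs_self _).trans h
  nlinarith

end FirstOrder

/-! ### Convergence of sequences under a Kurdyka–Łojasiewicz inequality -/

/-- One step of the argument. With `s = H - F*`, `s' = H' - F*` (consecutive excess values of the
Lyapunov function) and `t = F - F*` (the excess of the objective itself), the Kurdyka–Łojasiewicz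
inequality is available only at `t`. If `t ≥ s / 2`, it passes to `s / 2` by concavity; otherwise
`s` is dominated by the squared step `q ^ 2`, and `√` desingularizes it. -/
theorem step_le_of_KL {ξ : ℝ → ℝ} {R A b c p q d s s' t : ℝ}
    (hconc : ConcaveOn ℝ (Set.Icc 0 R) ξ)
    (hdiff : ∀ z ∈ Set.Ioo 0 R, DifferentiableAt ℝ ξ z)
    (hpos : ∀ z ∈ Set.Ioo 0 R, 0 < deriv ξ z)
    (hA : 0 < A) (hb : 0 ≤ b) (hc : 0 ≤ c) (hq : 0 ≤ q) (hqp : q ≤ p)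
    (hs' : 0 ≤ s') (hsR : s < R) (hd : A * d ^ 2 ≤ s - s') (hts : t ≤ s)
    (htq : s - t ≤ c * q ^ 2) (hKL : 0 < t → 1 ≤ deriv ξ t * (b * p)) :
    d ≤ p / 4 + (2 * b + 2 * √(2 * c)) / A * ((ξ (s / 2) + √s) - (ξ (s' / 2) + √s')) := by
  have hp : 0 ≤ p := hq.trans hqp
  have hss' : s' ≤ s := by nlinarith [sq_nonneg d]
  have hs : 0 ≤ s := hs'.trans hss'
  have hsqrt : √s' ≤ √s := Real.sqrt_le_sqrt hss'
  have hw : 0 ≤ √(2 * c) := Real.sqrt_nonneg _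
  have hscale : 0 < s → deriv ξ (s / 2) * (s / 2 - s' / 2) ≤ ξ (s / 2) - ξ (s' / 2) := by
    intro hs0
    rcases hss'.eq_or_lt with h | h
    · simp [h]
    have h1 := hconc.le_slope_of_hasDerivAt (x := s' / 2) (y := s / 2)
      ⟨by linarith, by linarith⟩ ⟨by linarith, by linarith⟩ (by linarith)
      (hdiff (s / 2) ⟨by linarith, by linarith⟩).hasDerivAt
    rw [slope_def_field, le_div_iff₀ (by linarith)] at h1
    exact h1
  have hmono : ξ (s' / 2) ≤ ξ (s / 2) := by
    rcases hs.eq_or_lt with h | h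
    · have : s' = s := by linarith
      rw [this]
    · have h1 := hscale h
      have h2 := hpos (s / 2) ⟨by linarith, by linarith⟩
      nlinarith
  set e := (ξ (s / 2) + √s) - (ξ (s' / 2) + √s') with he
  have he0 : 0 ≤ e := by rw [he]; linarith
  set w := √(2 * c) with hwdef
  have hkey : s - s' ≤ (2 * b + 2 * w) * p * e := by
    rcases hs.eq_or_lt with h | hs0
    · have : 0 ≤ (2 * b + 2 * w) * p * e := by positivity
      linarith
    by_cases hcase : s / 2 ≤ t
    · have ht0 : 0 < t := by linarith
      have hanti : deriv ξ t ≤ deriv ξ (s / 2) := by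
        have hsub : ConcaveOn ℝ (Set.Ioo 0 R) ξ :=
          hconc.subset Set.Ioo_subset_Icc_self (convex_Ioo 0 R)
        exact hsub.antitoneOn_deriv hdiff ⟨by linarith, by linarith⟩ ⟨ht0, by linarith⟩ hcase
      have h1 : 1 ≤ deriv ξ (s / 2) * (b * p) :=
        (hKL ht0).trans (mul_le_mul_of_nonneg_right hanti (by positivity))
      have h2 := mul_le_mul_of_nonneg_right (hscale hs0) (show 0 ≤ b * p by positivity)
      have h3 : (s - s') / 2 ≤ (ξ (s / 2) - ξ (s' / 2)) * (b * p) := by nlinarith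
      have h4 : ξ (s / 2) - ξ (s' / 2) ≤ e := by rw [he]; linarith
      have h5 : (ξ (s / 2) - ξ (s' / 2)) * (b * p) ≤ e * (b * p) :=
        mul_le_mul_of_nonneg_right h4 (by positivity)
      have h6 : 0 ≤ 2 * w * p * e := by positivity
      nlinarith
    · push Not at hcase
      have h1 : √s ≤ w * q := by
        rw [hwdef, ← Real.sqrt_sq hq, ← Real.sqrt_mul (by linarith)]
        exact Real.sqrt_le_sqrt (by linarith)
      have h2 : √s ≤ w * p := h1.trans (mul_le_mul_of_nonneg_left hqp hw)
      have h3 : s - s' = (√s - √s') * (√s + √s') := by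
        nlinarith [Real.mul_self_sqrt hs, Real.mul_self_sqrt hs']
      have h4 : √s - √s' ≤ e := by rw [he]; linarith
      have h5 : (√s - √s') * (√s + √s') ≤ e * (2 * (w * p)) :=
        mul_le_mul h4 (by linarith) (by positivity) he0
      have h6 : 0 ≤ 2 * b * p * e := by positivity
      nlinarith
  have hMe : 0 ≤ (2 * b + 2 * w) / A * e := by positivity
  -- `d ^ 2 ≤ p * (M e) ≤ (p / 4 + M e) ^ 2`
  refine le_of_sq_le_sq ?_ (by positivity)
  have h1 : d ^ 2 ≤ p * ((2 * b + 2 * w) / A * e) := by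
    have : p * ((2 * b + 2 * w) / A * e) = (2 * b + 2 * w) * p * e / A := by ring
    rw [this, le_div_iff₀ hA]
    linarith
  nlinarith [sq_nonneg (p / 4 - (2 * b + 2 * w) / A * e)]

/-- A sequence that clusters at `a`, and whose steps near `a` are controlled by half of the two
preceding ones plus a telescoping term, converges to `a`: once it is close enough to `a`, it cannot
leave. -/
theorem tendsto_of_step_le {V : Type*} [PseudoMetricSpace V] {y : ℕ → V} {a : V} {G : ℕ → ℝ}
    {r : ℝ} (hr : 0 < r) (n₀ : ℕ) (hG0 : ∀ n, 0 ≤ G n) (hG : Tendsto G atTop (𝓝 0))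
    (hd : Tendsto (fun n => dist (y n) (y (n + 1))) atTop (𝓝 0))
    (hcl : MapClusterPt a atTop y)
    (hstep : ∀ n ≥ n₀, dist (y (n + 2)) a < r →
      dist (y (n + 2)) (y (n + 3)) ≤
        (dist (y n) (y (n + 1)) + dist (y (n + 1)) (y (n + 2))) / 4 + (G (n + 1) - G (n + 2))) :
    Tendsto y atTop (𝓝 a) := by
  set W : ℕ → ℝ := fun n =>
    dist (y n) (y (n + 1)) / 4 + dist (y (n + 1)) (y (n + 2)) / 2 + G (n + 1) with hWdef
  have hW0 : ∀ n, 0 ≤ W n := fun n => by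
    have := hG0 (n + 1)
    positivity
  have hW : Tendsto W atTop (𝓝 0) := by
    have h1 := hd.comp (tendsto_add_atTop_nat 1)
    have h2 := hG.comp (tendsto_add_atTop_nat 1)
    simpa [Function.comp_def] using ((hd.div_const 4).add (h1.div_const 2)).add h2
  rw [Metric.tendsto_atTop]
  intro ε hε
  set ε' := min ε r with hε'
  have hε'0 : 0 < ε' := lt_min hε hr
  obtain ⟨n₁, hn₁⟩ := eventually_atTop.1
    (hW.eventually (gt_mem_nhds (show (0 : ℝ) < ε' / 4 by positivity)))
  obtain ⟨k, hk, hka⟩ := frequently_atTop.1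
    ((mapClusterPt_iff_frequently.1 hcl) _ (Metric.ball_mem_nhds a (half_pos hε'0)))
    (max n₀ n₁ + 2)
  obtain ⟨n₂, rfl⟩ : ∃ n₂, k = n₂ + 2 := ⟨k - 2, by omega⟩
  have hn₂0 : n₀ ≤ n₂ := by have := le_max_left n₀ n₁; omega
  have hn₂1 : n₁ ≤ n₂ := by have := le_max_right n₀ n₁; omega
  rw [Metric.mem_ball] at hka
  have hWn : W n₂ < ε' / 4 := hn₁ n₂ hn₂1
  have hnear : ∀ n, dist (y (n + 2)) (y (n₂ + 2)) ≤ 2 * (W n₂ - W n) →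
      dist (y (n + 2)) a < ε' := fun n hn => by
    have := dist_triangle (y (n + 2)) (y (n₂ + 2)) a
    have := hW0 n
    linarith
  have hind : ∀ n, n₂ ≤ n → dist (y (n + 2)) (y (n₂ + 2)) ≤ 2 * (W n₂ - W n) := by
    intro n hn
    induction n, hn using Nat.le_induction with
    | base => simp
    | succ n hn ih =>
      have h1 := hstep n (hn₂0.trans hn) ((hnear n ih).trans_le (min_le_right _ _))
      have h2 := dist_triangle_left (y (n + 1 + 2)) (y (n₂ + 2)) (y (n + 2))
      have h3 : n + 1 + 2 = n + 3 := rfl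
      rw [h3] at h2 ⊢
      have h4 : W (n + 1) = dist (y (n + 1)) (y (n + 2)) / 4 + dist (y (n + 2)) (y (n + 3)) / 2
        + G (n + 2) := rfl
      have h5 : W n = dist (y n) (y (n + 1)) / 4 + dist (y (n + 1)) (y (n + 2)) / 2
        + G (n + 1) := rfl
      linarith
  refine ⟨n₂ + 2, fun n hn => ?_⟩
  obtain ⟨n', rfl⟩ : ∃ n', n = n' + 2 := ⟨n - 2, by omega⟩
  exact (hnear n' (hind n' (by omega))).trans_le (min_le_left _ _)

/-- Convergence of a sequence along which a Lyapunov function `H` decreases sufficiently, where `H`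
exceeds the objective `F` by at most a multiple of the squared last step and the
Kurdyka–Łojasiewicz inequality holds for `F` (not for `H`). The values `F n` and `H n` belong
to the point `y (n + 1)`. -/
theorem tendsto_of_KL {V : Type*} [PseudoMetricSpace V] {y : ℕ → V} {a : V} {F H : ℕ → ℝ}
    {Fs A b c r R : ℝ} {ξ : ℝ → ℝ}
    (hconc : ConcaveOn ℝ (Set.Icc 0 R) ξ)
    (hdiff : ∀ z ∈ Set.Ioo 0 R, DifferentiableAt ℝ ξ z)
    (hpos : ∀ z ∈ Set.Ioo 0 R, 0 < deriv ξ z)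
    (hnonneg : ∀ z ∈ Set.Icc 0 R, 0 ≤ ξ z) (hzero : ξ 0 = 0)
    (hcont : ContinuousWithinAt ξ (Set.Icc 0 R) 0)
    (hA : 0 < A) (hb : 0 ≤ b) (hc : 0 ≤ c) (hr : 0 < r) (hR : 0 < R)
    (hHlim : Tendsto H atTop (𝓝 Fs))
    (hdec : ∀ n, A * dist (y (n + 1)) (y (n + 2)) ^ 2 ≤ H n - H (n + 1))
    (hFH : ∀ n, F n ≤ H n) (hHF : ∀ n, H n ≤ F n + c * dist (y n) (y (n + 1)) ^ 2)
    (hd : Tendsto (fun n => dist (y n) (y (n + 1))) atTop (𝓝 0))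
    (hcl : MapClusterPt a atTop y)
    (hKL : ∀ n, dist (y (n + 2)) a < r → Fs < F (n + 1) → F (n + 1) < Fs + R →
      1 ≤ deriv ξ (F (n + 1) - Fs) *
        (b * (dist (y n) (y (n + 1)) + dist (y (n + 1)) (y (n + 2))))) :
    Tendsto y atTop (𝓝 a) := by
  have hanti : Antitone H := antitone_nat_of_succ_le fun n => by
    have h1 := hdec n
    have h2 : 0 ≤ A * dist (y (n + 1)) (y (n + 2)) ^ 2 := by positivity
    linarith
  have hs0 : ∀ n, 0 ≤ H n - Fs := fun n => sub_nonneg.2 (hanti.le_of_tendsto hHlim n)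
  have hs : Tendsto (fun n => H n - Fs) atTop (𝓝 0) := by
    simpa using hHlim.sub_const Fs
  obtain ⟨n₀, hn₀⟩ := eventually_atTop.1 (hs.eventually (gt_mem_nhds hR))
  set M := (2 * b + 2 * √(2 * c)) / A with hM
  have hM0 : 0 ≤ M := by positivity
  -- the telescoping term, cut off outside the range where `ξ` is known to be nonnegative
  set G : ℕ → ℝ := fun n => max 0 (M * (ξ ((H n - Fs) / 2) + √(H n - Fs))) with hG
  have hGeq : ∀ n ≥ n₀, G n = M * (ξ ((H n - Fs) / 2) + √(H n - Fs)) := fun n hn => by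
    refine max_eq_right (mul_nonneg hM0 (add_nonneg (hnonneg _ ⟨?_, ?_⟩) (Real.sqrt_nonneg _)))
    · linarith [hs0 n]
    · linarith [hn₀ n hn, hs0 n]
  refine tendsto_of_step_le hr n₀ (G := G) (fun n => le_max_left _ _) ?_ hd hcl ?_
  · have h1 : Tendsto (fun n => ξ ((H n - Fs) / 2)) atTop (𝓝 0) := by
      have h2 : Tendsto (fun n => (H n - Fs) / 2) atTop (𝓝[Set.Icc 0 R] 0) := by
        refine tendsto_nhdsWithin_iff.2 ⟨by simpa using hs.div_const 2, ?_⟩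
        filter_upwards [eventually_ge_atTop n₀] with n hn
        exact ⟨by linarith [hs0 n], by linarith [hn₀ n hn, hs0 n]⟩
      have h3 := hcont.tendsto.comp h2
      rwa [hzero] at h3
    have h2 : Tendsto (fun n => √(H n - Fs)) atTop (𝓝 0) := by
      simpa using hs.sqrt
    have h3 := (tendsto_const_nhds (x := (0 : ℝ)) (f := atTop (α := ℕ))).max
      ((h1.add h2).const_mul M)
    simpa using h3
  · intro n hn hya
    rw [hGeq (n + 1) (by omega), hGeq (n + 2) (by omega), ← mul_sub]
    refine step_le_of_KL hconc hdiff hpos hA hb hc (q := dist (y (n + 1)) (y (n + 2)))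
      (t := F (n + 1) - Fs) dist_nonneg (le_add_of_nonneg_left dist_nonneg) (hs0 _)
      (hn₀ _ (by omega)) ?_ ?_ ?_ ?_
    · have := hdec (n + 1)
      linarith
    · linarith [hFH (n + 1)]
    · have := hHF (n + 1)
      linarith
    · intro h0
      refine hKL n hya (by linarith) ?_
      have := hn₀ (n + 1) (by omega)
      linarith [hFH (n + 1)]

/-! ### Finite sums of extended reals -/

section ERealSums

variable {ι : Type*}

theorem coe_finset_sum (s : Finset ι) (a : ι → ℝ) :
    ((∑ i ∈ s, a i : ℝ) : EReal) = ∑ i ∈ s, (a i : EReal) := by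
  classical
  induction s using Finset.induction_on with
  | empty => simp
  | insert i s hi ih => rw [Finset.sum_insert hi, Finset.sum_insert hi, EReal.coe_add, ih]

theorem sum_ne_bot (s : Finset ι) {a : ι → EReal} (ha : ∀ i ∈ s, a i ≠ ⊥) :
    ∑ i ∈ s, a i ≠ ⊥ := by
  classical
  induction s using Finset.induction_on with
  | empty => simp
  | insert i s hi ih =>
    rw [Finset.sum_insert hi, ne_eq, EReal.add_eq_bot_iff, not_or]
    exact ⟨ha i (Finset.mem_insert_self i s), ih fun j hj => ha j (Finset.mem_insert_of_mem hj)⟩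

theorem sum_eq_top {s : Finset ι} {a : ι → EReal} (ha : ∀ i ∈ s, a i ≠ ⊥) {i : ι} (hi : i ∈ s)
    (hai : a i = ⊤) : ∑ i ∈ s, a i = ⊤ := by
  classical
  rw [← Finset.add_sum_erase s a hi, hai, EReal.top_add_of_ne_bot]
  exact sum_ne_bot _ fun j hj => ha j (Finset.mem_of_mem_erase hj)

theorem sum_eq_coe_sum_toReal (s : Finset ι) {a : ι → EReal} (ha : ∀ i ∈ s, a i ≠ ⊥)
    (ha' : ∀ i ∈ s, a i ≠ ⊤) : ∑ i ∈ s, a i = ((∑ i ∈ s, (a i).toReal : ℝ) : EReal) := by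
  rw [coe_finset_sum]
  exact Finset.sum_congr rfl fun i hi => (EReal.coe_toReal (ha' i hi) (ha i hi)).symm

theorem tendsto_sum_ereal {α : Type*} {l : Filter α} (s : Finset ι) {a : ι → α → EReal}
    {b : ι → EReal} (h : ∀ i ∈ s, Tendsto (a i) l (𝓝 (b i))) (hb : ∀ i ∈ s, b i ≠ ⊥)
    (hb' : ∀ i ∈ s, b i ≠ ⊤) :
    Tendsto (fun k => ∑ i ∈ s, a i k) l (𝓝 (∑ i ∈ s, b i)) := by
  classical
  induction s using Finset.induction_on with
  | empty => simpa using tendsto_const_nhds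
  | insert i s hi ih =>
    simp only [Finset.sum_insert hi]
    have h1 := h i (Finset.mem_insert_self i s)
    have h2 := ih (fun j hj => h j (Finset.mem_insert_of_mem hj))
      (fun j hj => hb j (Finset.mem_insert_of_mem hj))
      (fun j hj => hb' j (Finset.mem_insert_of_mem hj))
    have hc : ContinuousAt (fun p : EReal × EReal => p.1 + p.2) (b i, ∑ j ∈ s, b j) :=
      EReal.continuousAt_add (Or.inl (hb' i (Finset.mem_insert_self i s)))
        (Or.inl (hb i (Finset.mem_insert_self i s)))
    exact hc.tendsto.comp (h1.prodMk_nhds h2)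

theorem lowerSemicontinuousAt_sum_ereal {α : Type*} [TopologicalSpace α] {x : α} (s : Finset ι)
    {a : ι → α → EReal} (h : ∀ i ∈ s, LowerSemicontinuousAt (a i) x) (ha : ∀ i ∈ s, a i x ≠ ⊥) :
    LowerSemicontinuousAt (fun z => ∑ i ∈ s, a i z) x := by
  classical
  induction s using Finset.induction_on with
  | empty => simpa using lowerSemicontinuousAt_const
  | insert i s hi ih =>
    simp only [Finset.sum_insert hi]
    have hbot := sum_ne_bot s fun j hj => ha j (Finset.mem_insert_of_mem hj)
    refine (h i (Finset.mem_insert_self i s)).add' (ih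
      (fun j hj => h j (Finset.mem_insert_of_mem hj))
      (fun j hj => ha j (Finset.mem_insert_of_mem hj))) ?_
    exact EReal.continuousAt_add (Or.inr hbot) (Or.inl (ha i (Finset.mem_insert_self i s)))

end ERealSums

/-! ### Subdifferential calculus -/

section Subdifferential

variable {V : Type*} [NormedAddCommGroup V] [InnerProductSpace ℝ V]

/-- Limiting subgradients as a closure of the graph of Fréchet subgradients together with the
function values, which replaces diagonal arguments. -/
theorem mem_limSubdiff_iff_closure {h : V → EReal} {x v : V} :
    v ∈ limSubdiff h x ↔ h x ≠ ⊤ ∧ h x ≠ ⊥ ∧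
      (x, h x, v) ∈ closure {p : V × EReal × V | p.2.1 = h p.1 ∧ p.2.2 ∈ frechetSubdiff h p.1} := by
  simp only [limSubdiff, Set.mem_ofPred_eq]
  refine and_congr_right fun _ => and_congr_right fun _ => ?_
  rw [mem_closure_iff_seq_limit]
  constructor
  · rintro ⟨xs, vs, h1, h2, h3, h4⟩
    exact ⟨fun k => (xs k, h (xs k), vs k), fun k => ⟨rfl, h3 k⟩,
      h1.prodMk_nhds (h2.prodMk_nhds h4)⟩
  · rintro ⟨p, hp, hlim⟩
    have h1 := (continuous_fst.tendsto _).comp hlim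
    have h2 := (continuous_snd.tendsto _).comp hlim
    refine ⟨fun k => (p k).1, fun k => (p k).2.2, h1, ?_, fun k => (hp k).2,
      (continuous_snd.tendsto _).comp h2⟩
    have h3 := (continuous_fst.tendsto _).comp h2
    refine h3.congr fun k => (hp k).1

/-- The limiting subdifferential is closed under limits along which the function values
converge. -/
theorem mem_limSubdiff_of_tendsto {h : V → EReal} {x v : V} {xs vs : ℕ → V} (htop : h x ≠ ⊤)
    (hbot : h x ≠ ⊥) (hxs : Tendsto xs atTop (𝓝 x))
    (hval : Tendsto (fun k => h (xs k)) atTop (𝓝 (h x))) (hvs : Tendsto vs atTop (𝓝 v))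
    (hmem : ∀ k, vs k ∈ limSubdiff h (xs k)) : v ∈ limSubdiff h x := by
  refine mem_limSubdiff_iff_closure.2 ⟨htop, hbot, ?_⟩
  refine isClosed_closure.mem_of_tendsto (hxs.prodMk_nhds (hval.prodMk_nhds hvs))
    (Eventually.of_forall fun k => (mem_limSubdiff_iff_closure.1 (hmem k)).2.2)

theorem frechetSubdiff_subset_limSubdiff (h : V → EReal) (x : V) :
    frechetSubdiff h x ⊆ limSubdiff h x := fun v hv =>
  ⟨hv.1, hv.2.1, fun _ => x, fun _ => v, tendsto_const_nhds, tendsto_const_nhds, fun _ => hv,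
    tendsto_const_nhds⟩

/-- A global affine minorant which is exact at `x` gives a limiting subgradient. -/
theorem mem_limSubdiff_of_forall_le {h : V → EReal} {x v : V} (htop : h x ≠ ⊤) (hbot : h x ≠ ⊥)
    (hv : ∀ y, h x + ((inner ℝ v (y - x) : ℝ) : EReal) ≤ h y) : v ∈ limSubdiff h x := by
  refine frechetSubdiff_subset_limSubdiff h x ⟨htop, hbot, fun ε hε => Eventually.of_forall
    fun y => le_trans ?_ (hv y)⟩
  refine add_le_add le_rfl (EReal.coe_le_coe_iff.2 ?_)
  have : 0 ≤ ε * ‖y - x‖ := by positivity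
  linarith

end Subdifferential

section Separable

variable {m : ℕ} {E : Fin m → Type*} {f : PiLp 2 E → ℝ} {g : ∀ i, E i → EReal}
  {X : ∀ i, Set (E i)}

theorem addIndicator_ne_bot (hg : ∀ i t, g i t ≠ ⊥) (i : Fin m) (t : E i) :
    addIndicator (X i) (g i) t ≠ ⊥ := by
  by_cases h : t ∈ X i <;> simp [addIndicator, h, hg]

theorem Phi_eq_add_sum (hg : ∀ i t, g i t ≠ ⊥) :
    Phi f g X = fun y => (f y : EReal) + ∑ i, addIndicator (X i) (g i) (y i) := by
  funext y
  by_cases h : y ∈ feasible X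
  · have h1 : Phi f g X y = objective f g y := if_pos h
    rw [h1, objective]
    congr 1
    exact Finset.sum_congr rfl fun i _ => (if_pos (h i)).symm
  · obtain ⟨i, hi⟩ : ∃ i, y i ∉ X i := by simpa [feasible] using h
    rw [sum_eq_top (fun j _ => addIndicator_ne_bot hg j (y j)) (Finset.mem_univ i)
      (if_neg hi), EReal.coe_add_top]
    exact if_neg h

end Separable

section SumRule

variable {m : ℕ} {E : Fin m → Type*} [∀ i, NormedAddCommGroup (E i)]
  [∀ i, InnerProductSpace ℝ (E i)] [∀ i, CompleteSpace (E i)]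

theorem gradient_add_mem_frechetSubdiff {f : PiLp 2 E → ℝ} {h : ∀ i, E i → EReal}
    {x v : PiLp 2 E} (hf : DifferentiableAt ℝ f x) (hv : ∀ i, v i ∈ frechetSubdiff (h i) (x i)) :
    gradient f x + v ∈ frechetSubdiff (fun y => (f y : EReal) + ∑ i, h i (y i)) x := by
  have htop : ∀ i, h i (x i) ≠ ⊤ := fun i => (hv i).1
  have hbot : ∀ i, h i (x i) ≠ ⊥ := fun i => (hv i).2.1
  have hval : ((f x : ℝ) : EReal) + ∑ i, h i (x i) =
      ((f x + ∑ i, (h i (x i)).toReal : ℝ) : EReal) := by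
    rw [sum_eq_coe_sum_toReal _ (fun i _ => hbot i) (fun i _ => htop i), EReal.coe_add]
  refine ⟨?_, ?_, fun ε hε => ?_⟩
  · simp only [hval]; exact EReal.coe_ne_top _
  · simp only [hval]; exact EReal.coe_ne_bot _
  -- the tolerance `ε` is shared by `f` and the `m` blocks
  set ε' : ℝ := ε / (m + 1) with hε'
  have hε'0 : 0 < ε' := by positivity
  have hblocks : ∀ᶠ y in 𝓝 x, ∀ i, h i (x i) +
      ((inner ℝ (v i) (y i - x i) - ε' * ‖y i - x i‖ : ℝ) : EReal) ≤ h i (y i) := by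
    refine eventually_all.2 fun i => ?_
    have hproj : Tendsto (fun y : PiLp 2 E => y i) (𝓝 x) (𝓝 (x i)) :=
      (PiLp.continuous_apply 2 E i).tendsto x
    exact hproj.eventually ((hv i).2.2 ε' hε'0)
  have hsmooth := (Asymptotics.isLittleO_iff.1 hf.hasFDerivAt.isLittleO) hε'0
  filter_upwards [hblocks, hsmooth] with y hy hfy
  simp only [hval]
  have hsum : ((∑ i, ((h i (x i)).toReal + (inner ℝ (v i) (y i - x i) - ε' * ‖y i - x i‖)) : ℝ) :
      EReal) ≤ ∑ i, h i (y i) := by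
    rw [coe_finset_sum]
    refine Finset.sum_le_sum fun i _ => ?_
    rw [EReal.coe_add, EReal.coe_toReal (htop i) (hbot i)]
    exact hy i
  rw [← EReal.coe_add]
  refine le_trans ?_ (add_le_add le_rfl hsum)
  rw [← EReal.coe_add, EReal.coe_le_coe_iff]
  have hinner : inner ℝ (gradient f x + v) (y - x) =
      fderiv ℝ f x (y - x) + ∑ i, inner ℝ (v i) (y i - x i) := by
    rw [inner_add_left, PiLp.inner_apply]
    congr 1
    exact InnerProductSpace.toDual_symm_apply (𝕜 := ℝ) (E := PiLp 2 E)
  have hnorm : ∑ i, ε' * ‖y i - x i‖ ≤ m * (ε' * ‖y - x‖) := by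
    calc ∑ i, ε' * ‖y i - x i‖ ≤ ∑ _i : Fin m, ε' * ‖y - x‖ :=
          Finset.sum_le_sum fun i _ =>
            mul_le_mul_of_nonneg_left (PiLp.norm_apply_le (y - x) i) hε'0.le
      _ = m * (ε' * ‖y - x‖) := by simp
  have hεm : ε * ‖y - x‖ = m * (ε' * ‖y - x‖) + ε' * ‖y - x‖ := by
    rw [hε']; field_simp
  have h1 := neg_abs_le (f y - f x - fderiv ℝ f x (y - x))
  rw [Real.norm_eq_abs] at hfy
  rw [hinner, Finset.sum_add_distrib, Finset.sum_sub_distrib]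
  linarith

theorem continuous_gradient {f : PiLp 2 E → ℝ} (hf : ContDiff ℝ 1 f) :
    Continuous (gradient f) :=
  (InnerProductSpace.toDual ℝ (PiLp 2 E)).symm.continuous.comp (hf.continuous_fderiv one_ne_zero)

/-- Sum rule for a continuously differentiable function and a separable one. -/
theorem gradient_add_mem_limSubdiff {f : PiLp 2 E → ℝ} {h : ∀ i, E i → EReal}
    {x v : PiLp 2 E} (hf : ContDiff ℝ 1 f) (hv : ∀ i, v i ∈ limSubdiff (h i) (x i)) :
    gradient f x + v ∈ limSubdiff (fun y => (f y : EReal) + ∑ i, h i (y i)) x := by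
  have htop : ∀ i, h i (x i) ≠ ⊤ := fun i => (hv i).1
  have hbot : ∀ i, h i (x i) ≠ ⊥ := fun i => (hv i).2.1
  choose _ _ xs vs hxs hval hmem hvs using hv
  have hval' : ((f x : ℝ) : EReal) + ∑ i, h i (x i) =
      ((f x + ∑ i, (h i (x i)).toReal : ℝ) : EReal) := by
    rw [sum_eq_coe_sum_toReal _ (fun i _ => hbot i) (fun i _ => htop i), EReal.coe_add]
  have hlift : ∀ {ws : ∀ i, ℕ → E i} {w : PiLp 2 E}, (∀ i, Tendsto (ws i) atTop (𝓝 (w i))) →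
      Tendsto (fun k => (WithLp.toLp 2 fun i => ws i k : PiLp 2 E)) atTop (𝓝 w) := by
    intro ws w hw
    exact ((PiLp.continuous_toLp 2 E).tendsto w.ofLp).comp (tendsto_pi_nhds.2 hw)
  have hX := hlift hxs
  refine ⟨?_, ?_, fun k => WithLp.toLp 2 fun i => xs i k,
    fun k => gradient f (WithLp.toLp 2 fun i => xs i k) + WithLp.toLp 2 fun i => vs i k,
    hX, ?_, ?_, ?_⟩
  · simp only [hval']; exact EReal.coe_ne_top _
  · simp only [hval']; exact EReal.coe_ne_bot _
  · have h1 : Tendsto (fun k => ((f (WithLp.toLp 2 fun i => xs i k) : ℝ) : EReal)) atTop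
        (𝓝 ((f x : ℝ) : EReal)) :=
      EReal.tendsto_coe.2 ((hf.continuous.tendsto x).comp hX)
    have h2 := tendsto_sum_ereal Finset.univ (fun i _ => hval i) (fun i _ => hbot i)
      (fun i _ => htop i)
    exact (EReal.continuousAt_add (Or.inl (EReal.coe_ne_top _))
      (Or.inl (EReal.coe_ne_bot _))).tendsto.comp (h1.prodMk_nhds h2)
  · intro k
    exact gradient_add_mem_frechetSubdiff (hf.differentiable one_ne_zero _) fun i => hmem i k
  · exact (((continuous_gradient hf).tendsto x).comp hX).add (hlift hvs)

end SumRule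

/-! ### One block subproblem -/

section Subproblem

variable {V : Type*} [NormedAddCommGroup V] [NormedSpace ℝ V]

/-- First-order optimality for the sum of a differentiable function `S` and a convex function `U`
over `X`. -/
theorem le_of_isMin_add_convex {S : V → ℝ} {U : V → EReal} {X : Set V} {v : V}
    (hX : Convex ℝ {p : V × ℝ | p.1 ∈ X ∧ U p.1 ≤ (p.2 : EReal)})
    (hbot : ∀ t ∈ X, U t ≠ ⊥) (hv : v ∈ X) (hvtop : U v ≠ ⊤) (hS : DifferentiableAt ℝ S v)
    (hmin : ∀ t ∈ X, (S v : EReal) + U v ≤ (S t : EReal) + U t) {t : V} (ht : t ∈ X) :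
    U v + ((-(fderiv ℝ S v (t - v)) : ℝ) : EReal) ≤ U t := by
  by_cases htop : U t = ⊤
  · rw [htop]; exact le_top
  have hUt := EReal.coe_toReal htop (hbot t ht)
  have hUv := EReal.coe_toReal hvtop (hbot v hv)
  have key : (U v).toReal - (U t).toReal ≤ fderiv ℝ S v (t - v) := by
    refine le_fderiv_of_forall_le (e := 0) hS fun r h0 h1 => ?_
    have hmem := hX (x := (v, (U v).toReal)) ⟨hv, hUv.ge⟩ (y := (t, (U t).toReal)) ⟨ht, hUt.ge⟩
      (sub_nonneg.2 h1.le) h0.le (by ring)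
    have hpt : (1 - r) • v + r • t = v + r • (t - v) := by module
    simp only [Prod.smul_mk, Prod.mk_add_mk, smul_eq_mul, hpt] at hmem
    have h2 := (hmin _ hmem.1).trans (add_le_add le_rfl hmem.2)
    rw [← hUv, ← EReal.coe_add, ← EReal.coe_add, EReal.coe_le_coe_iff, hUv] at h2
    linarith
  rw [← hUv, ← hUt, ← EReal.coe_add, EReal.coe_le_coe_iff]
  linarith

/-- Decrease in one block, in real terms. `v` is the new block, `p` the old one, `b` the
extrapolated one; `hopt` is the optimality condition of the subproblem tested at `p`. -/
theorem block_decrease {h q : V → ℝ} {v p b : V} {L l γv γp : ℝ}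
    (hupper : h v - h b - fderiv ℝ h b (v - b) ≤ L * (q v - q b - fderiv ℝ q b (v - b)))
    (hlower : -l * (q p - q b - fderiv ℝ q b (p - b)) ≤ h p - h b - fderiv ℝ h b (p - b))
    (hopt : γv - (L * (fderiv ℝ q v (p - v) - fderiv ℝ q b (p - v)) + fderiv ℝ h b (p - v)) ≤ γp) :
    h v + γv + L * (q p - q v - fderiv ℝ q v (p - v)) ≤
      h p + γp + (L + l) * (q p - q b - fderiv ℝ q b (p - b)) := by
  have hq : fderiv ℝ q b (p - v) = fderiv ℝ q b (p - b) - fderiv ℝ q b (v - b) := by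
    rw [← map_sub]; congr 1; abel
  have hh : fderiv ℝ h b (p - v) = fderiv ℝ h b (p - b) - fderiv ℝ h b (v - b) := by
    rw [← map_sub]; congr 1; abel
  rw [hq, hh] at hopt
  linarith

/-- The smooth part of a subproblem has derivative `L (∇q v - ∇q b) + w` at `v`. -/
theorem hasFDerivAt_smooth {q : V → ℝ} {v b : V} (L : ℝ) (w : V →L[ℝ] ℝ)
    (hq : DifferentiableAt ℝ q v) :
    HasFDerivAt (fun t => L * (q t - q b - fderiv ℝ q b (t - b)) + w t)
      (L • (fderiv ℝ q v - fderiv ℝ q b) + w) v := by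
  have h1 : HasFDerivAt (fun t => fderiv ℝ q b (t - b)) (fderiv ℝ q b) v := by
    exact (fderiv ℝ q b).hasFDerivAt.comp v ((hasFDerivAt_id v).sub_const b)
  exact (((hq.hasFDerivAt.sub_const (q b)).sub h1).const_mul L).add w.hasFDerivAt

end Subproblem

/-! ### Block calculus -/

section Isometry

variable {V W : Type*} [NormedAddCommGroup V] [NormedSpace ℝ V] [NormedAddCommGroup W]
  [NormedSpace ℝ W]

theorem hasFDerivAt_comp_isometry {h : W → ℝ} {ι : V →ₗᵢ[ℝ] W} {c : W} {t : V}
    (hh : DifferentiableAt ℝ h (c + ι t)) :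
    HasFDerivAt (fun t => h (c + ι t)) ((fderiv ℝ h (c + ι t)).comp ι.toContinuousLinearMap) t :=
  hh.hasFDerivAt.comp t (ι.toContinuousLinearMap.hasFDerivAt.const_add c)

theorem norm_fderiv_comp_isometry_sub_le {h : W → ℝ} {ι : V →ₗᵢ[ℝ] W} {c z : W} {t : V}
    {B : Set W} {K : NNReal} (hdiff : Differentiable ℝ h)
    (hK : LipschitzOnWith K (fderiv ℝ h) B) (hz : z ∈ B) (ht : c + ι t ∈ B) :
    ‖(fderiv ℝ h z).comp ι.toContinuousLinearMap - fderiv ℝ (fun t => h (c + ι t)) t‖ ≤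
      K * dist z (c + ι t) := by
  rw [(hasFDerivAt_comp_isometry (hdiff _)).fderiv, ← ContinuousLinearMap.sub_comp]
  refine le_trans (ContinuousLinearMap.opNorm_le_bound _ (norm_nonneg _) fun d => ?_)
    ((dist_eq_norm _ _).symm.trans_le (hK.dist_le_mul _ hz _ ht))
  have := (fderiv ℝ h z - fderiv ℝ h (c + ι t)).le_opNorm (ι d)
  rwa [ι.norm_map] at this

end Isometry

section Blocks

variable {m : ℕ} {E : Fin m → Type*}

theorem upd_apply_self (y : PiLp 2 E) (i : Fin m) (t : E i) : upd y i t i = t :=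
  Function.update_self i t y.ofLp

theorem upd_apply_ne (y : PiLp 2 E) {i j : Fin m} (h : j ≠ i) (t : E i) : upd y i t j = y j :=
  Function.update_of_ne h t y.ofLp

theorem inter_apply_self (x : ℕ → PiLp 2 E) (n : ℕ) (i : Fin m) : inter x n i i = x n i := by
  simp [inter]

/-- Cyclic updates telescope: the block increments of `f` in one sweep add up to the total
increment. -/
theorem sum_block_increments (f : PiLp 2 E → ℝ) (x : ℕ → PiLp 2 E) (n : ℕ) :
    ∑ i, (f (upd (inter x n i) i (x (n + 1) i)) - f (inter x n i)) = f (x (n + 1)) - f (x n) := by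
  set P : ℕ → PiLp 2 E := fun j =>
    WithLp.toLp 2 fun k : Fin m => if (k : ℕ) < j then x (n + 1) k else x n k with hP
  have h0 : P 0 = x n := by ext k; simp [hP]
  have hm : P m = x (n + 1) := by ext k; simp [hP]
  have hi : ∀ i : Fin m, inter x n i = P i := fun i => by
    ext k; simp [hP, inter]
  have hs : ∀ i : Fin m, upd (inter x n i) i (x (n + 1) i) = P (i + 1) := fun i => by
    ext k
    rcases eq_or_ne k i with rfl | h
    · simp [hP, upd_apply_self]
    · have h1 : (k : ℕ) ≠ i := fun h' => h (Fin.ext h')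
      have h2 : k ≤ i ↔ k < i := ⟨fun h' => lt_of_le_of_ne h' h, le_of_lt⟩
      simp [hP, upd_apply_ne _ h, inter, h2]
  calc ∑ i, (f (upd (inter x n i) i (x (n + 1) i)) - f (inter x n i))
      = ∑ i : Fin m, (f (P (i + 1)) - f (P i)) :=
        Finset.sum_congr rfl fun i _ => by rw [hs, hi]
    _ = ∑ j ∈ Finset.range m, (f (P (j + 1)) - f (P j)) :=
        Fin.sum_univ_eq_sum_range (fun j => f (P (j + 1)) - f (P j)) m
    _ = f (x (n + 1)) - f (x n) := by rw [Finset.sum_range_sub (fun j => f (P j)), h0, hm]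

variable [∀ i, NormedAddCommGroup (E i)]

theorem upd_eq_add (y : PiLp 2 E) (i : Fin m) (t : E i) :
    upd y i t = y + PiLp.single 2 i (t - y i) := by
  ext j
  rcases eq_or_ne j i with rfl | h
  · simp [upd_apply_self]
  · simp [upd_apply_ne y h, PiLp.single_eq_of_ne 2 h]

theorem upd_sub_upd (y : PiLp 2 E) (i : Fin m) (s t : E i) :
    upd y i s - upd y i t = PiLp.single 2 i (s - t) := by
  rw [upd_eq_add, upd_eq_add, add_sub_add_left_eq_sub, ← PiLp.single_sub]
  congr 1
  abel

theorem norm_upd_sub_upd (y : PiLp 2 E) (i : Fin m) (s t : E i) :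
    ‖upd y i s - upd y i t‖ = ‖s - t‖ := by
  rw [upd_sub_upd, PiLp.norm_single]

theorem upd_inter_self (x : ℕ → PiLp 2 E) (n : ℕ) (i : Fin m) :
    upd (inter x n i) i (x n i) = inter x n i := by
  rw [upd_eq_add, inter_apply_self, sub_self]
  simp

theorem norm_le_norm_of_forall {a b : PiLp 2 E} (h : ∀ i, ‖a i‖ ≤ ‖b i‖) : ‖a‖ ≤ ‖b‖ := by
  refine le_of_sq_le_sq ?_ (norm_nonneg _)
  rw [PiLp.norm_sq_eq_of_L2, PiLp.norm_sq_eq_of_L2]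
  exact Finset.sum_le_sum fun i _ => pow_le_pow_left₀ (norm_nonneg _) (h i) 2

theorem norm_le_of_forall_le {a : PiLp 2 E} {C : ℝ} (h : ∀ i, ‖a i‖ ≤ C) :
    ‖a‖ ≤ m * C := by
  have h1 : ‖a‖ ^ 2 ≤ (∑ i, ‖a i‖) ^ 2 := by
    rw [PiLp.norm_sq_eq_of_L2]
    exact Finset.sum_sq_le_sq_sum_of_nonneg fun i _ => norm_nonneg _
  have h2 : ∑ i, ‖a i‖ ≤ m * C := by
    simpa using Finset.sum_le_sum fun i (_ : i ∈ Finset.univ) => h i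
  exact (le_of_sq_le_sq h1 (Finset.sum_nonneg fun i _ => norm_nonneg _)).trans h2

theorem norm_inter_sub_le (x : ℕ → PiLp 2 E) (n : ℕ) (i : Fin m) :
    ‖x (n + 1) - inter x n i‖ ≤ dist (x n) (x (n + 1)) := by
  rw [dist_comm, dist_eq_norm]
  refine norm_le_norm_of_forall fun j => ?_
  by_cases h : j < i <;> simp [inter, h]

theorem dist_apply_le (a b : PiLp 2 E) (i : Fin m) : ‖a i - b i‖ ≤ dist a b := by
  rw [dist_eq_norm]
  exact PiLp.norm_apply_le (a - b) i

variable [∀ i, InnerProductSpace ℝ (E i)]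

/-- The isometric embedding of the `i`-th block. -/
def blockIncl (i : Fin m) : E i →ₗᵢ[ℝ] PiLp 2 E where
  toFun := PiLp.single 2 i
  map_add' _ _ := PiLp.single_add 2 i
  map_smul' c t := by
    ext j
    rcases eq_or_ne j i with rfl | h
    · simp
    · simp [PiLp.single_eq_of_ne 2 h]
  norm_map' t := PiLp.norm_single 2 E i t

theorem upd_eq_add_blockIncl (y : PiLp 2 E) (i : Fin m) (t : E i) :
    upd y i t = (y - blockIncl i (y i)) + blockIncl i t := by
  rw [upd_eq_add, PiLp.single_sub]
  change y + (blockIncl i t - blockIncl i (y i)) = (y - blockIncl i (y i)) + blockIncl i t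
  abel

theorem block_eq_comp {β : Type*} (h : PiLp 2 E → β) (i : Fin m) (y : PiLp 2 E) :
    block h i y = fun t => h ((y - blockIncl i (y i)) + blockIncl i t) := by
  funext t
  rw [block, upd_eq_add_blockIncl]

theorem differentiable_block {h : PiLp 2 E → ℝ} (hdiff : Differentiable ℝ h) (i : Fin m)
    (y : PiLp 2 E) : Differentiable ℝ (block h i y) := fun t => by
  rw [block_eq_comp]
  exact (hasFDerivAt_comp_isometry (hdiff _)).differentiableAt

theorem norm_fderiv_comp_sub_fderiv_block_le {h : PiLp 2 E → ℝ} {i : Fin m} {y z : PiLp 2 E}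
    {t : E i} {B : Set (PiLp 2 E)} {K : NNReal} (hdiff : Differentiable ℝ h)
    (hK : LipschitzOnWith K (fderiv ℝ h) B) (hz : z ∈ B) (ht : upd y i t ∈ B) :
    ‖(fderiv ℝ h z).comp (blockIncl i).toContinuousLinearMap - fderiv ℝ (block h i y) t‖ ≤
      K * dist z (upd y i t) := by
  rw [upd_eq_add_blockIncl] at ht ⊢
  rw [block_eq_comp]
  exact norm_fderiv_comp_isometry_sub_le hdiff hK hz ht

theorem norm_fderiv_block_sub_le {h : PiLp 2 E → ℝ} {i : Fin m} {y : PiLp 2 E} {s t : E i}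
    {B : Set (PiLp 2 E)} {K : NNReal} (hdiff : Differentiable ℝ h)
    (hK : LipschitzOnWith K (fderiv ℝ h) B) (hs : upd y i s ∈ B) (ht : upd y i t ∈ B) :
    ‖fderiv ℝ (block h i y) s - fderiv ℝ (block h i y) t‖ ≤ K * ‖s - t‖ := by
  have h1 := norm_fderiv_comp_sub_fderiv_block_le hdiff hK hs ht
  have h2 : fderiv ℝ (block h i y) s =
      (fderiv ℝ h (upd y i s)).comp (blockIncl i).toContinuousLinearMap := by
    rw [block_eq_comp, upd_eq_add_blockIncl]
    exact (hasFDerivAt_comp_isometry (hdiff _)).fderiv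
  rwa [h2, ← norm_upd_sub_upd y, ← dist_eq_norm (upd y i s)]

theorem convex_preimage_upd (y : PiLp 2 E) (i : Fin m) {B : Set (PiLp 2 E)} (hB : Convex ℝ B) :
    Convex ℝ {t : E i | upd y i t ∈ B} := by
  intro s hs t ht a b ha hb hab
  have : upd y i (a • s + b • t) = a • upd y i s + b • upd y i t := by
    ext j
    rcases eq_or_ne j i with rfl | h
    · simp [upd_apply_self]
    · simp [upd_apply_ne _ h, ← add_smul, hab]
  change upd y i (a • s + b • t) ∈ B
  rw [this]
  exact hB hs ht ha hb hab

theorem gradient_apply_eq [∀ i, CompleteSpace (E i)] (f : PiLp 2 E → ℝ) (z : PiLp 2 E)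
    (i : Fin m) : (gradient f z) i = (InnerProductSpace.toDual ℝ (E i)).symm
      ((fderiv ℝ f z).comp (blockIncl i).toContinuousLinearMap) := by
  refine ext_inner_right ℝ fun t => ?_
  rw [InnerProductSpace.toDual_symm_apply]
  have h1 : inner ℝ (gradient f z) (blockIncl i t) = fderiv ℝ f z (blockIncl i t) :=
    InnerProductSpace.toDual_symm_apply (𝕜 := ℝ) (E := PiLp 2 E)
  have h2 : inner ℝ (gradient f z) (blockIncl i t) = inner ℝ ((gradient f z) i) t := by
    rw [PiLp.inner_apply, Finset.sum_eq_single i]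
    · congr 1
      exact PiLp.single_eq_same 2 i t
    · intro j _ hj
      have : (blockIncl i t) j = 0 := PiLp.single_eq_of_ne 2 hj t
      rw [this, inner_zero_right]
    · simp
  rw [← h2, h1]
  rfl

end Blocks

/-! ### Descent along the iterates -/

theorem LipschitzGradOnBounded.ne_top {V : Type*} [NormedAddCommGroup V] [InnerProductSpace ℝ V]
    {ψ : V → EReal} (h : LipschitzGradOnBounded ψ) (y : V) : ψ y ≠ ⊤ :=
  interior_subset ((h {y} Bornology.isBounded_singleton).1 y rfl).1

theorem LipschitzGradOnBounded.differentiable {V : Type*} [NormedAddCommGroup V]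
    [InnerProductSpace ℝ V] {ψ : V → EReal} (h : LipschitzGradOnBounded ψ) :
    Differentiable ℝ (re ψ) := fun y =>
  ((h {y} Bornology.isBounded_singleton).1 y rfl).2

/-- A finite family of positive reals has a positive lower bound. -/
theorem exists_pos_forall_le {ι : Type*} [Finite ι] {a : ι → ℝ} (ha : ∀ i, 0 < a i) :
    ∃ b > 0, ∀ i, b ≤ a i := by
  have h : ∀ᶠ b in 𝓝[>] (0 : ℝ), ∀ i, b ≤ a i := eventually_all.2 fun i => by
    filter_upwards [Ioo_mem_nhdsGT (ha i)] with b hb using hb.2.le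
  obtain ⟨b, hb, hb0⟩ := (h.and self_mem_nhdsWithin).exists
  exact ⟨b, hb0, hb⟩

theorem exists_nonneg_forall_le {ι : Type*} [Finite ι] (a : ι → ℝ) :
    ∃ b ≥ 0, ∀ i, a i ≤ b := by
  have h : ∀ᶠ b in atTop (α := ℝ), ∀ i, a i ≤ b :=
    eventually_all.2 fun i => eventually_ge_atTop _
  obtain ⟨b, hb, hb0⟩ := (h.and (eventually_ge_atTop 0)).exists
  exact ⟨b, hb0, hb⟩

section Descent

variable {m : ℕ} {E : Fin m → Type*} [∀ i, NormedAddCommGroup (E i)]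
  [∀ i, InnerProductSpace ℝ (E i)]

/-- The real values of the objective `F`. -/
def objRe (f : PiLp 2 E → ℝ) (g : ∀ i, E i → EReal) (y : PiLp 2 E) : ℝ :=
  f y + ∑ i, (g i (y i)).toReal

/-- The weighted divergence `L_i^k D_{φ_i^k}(x_i^k, x_i^{k+1})`, with `n = k + 1`. -/
noncomputable def stepDiv (φ : Fin m → PiLp 2 E → EReal) (L : Fin m → PiLp 2 E → ℝ) (x : ℕ → PiLp 2 E)
    (n : ℕ) (i : Fin m) : ℝ :=
  L i (inter x n i) * bregman (kern φ x n i) (x n i) (x (n + 1) i)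

/-- The derivative at `x_i^{k+1}` of the smooth part of the `i`-th subproblem at iteration `k`. -/
noncomputable def smoothDeriv (f : PiLp 2 E → ℝ) (φ : Fin m → PiLp 2 E → EReal) (L : Fin m → PiLp 2 E → ℝ)
    (β : ℕ → Fin m → ℝ) (x : ℕ → PiLp 2 E) (k : ℕ) (i : Fin m) : E i →L[ℝ] ℝ :=
  L i (inter x (k + 1) i) • (fderiv ℝ (re (kern φ x (k + 1) i)) (x (k + 2) i) -
    fderiv ℝ (re (kern φ x (k + 1) i)) (xbar β x k i)) +
    fderiv ℝ (block f i (inter x (k + 1) i)) (xbar β x k i)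

variable {f : PiLp 2 E → ℝ} {g : ∀ i, E i → EReal} {X : ∀ i, Set (E i)}
  {φ : Fin m → PiLp 2 E → EReal} {L l : Fin m → PiLp 2 E → ℝ}
  {u : ∀ i, E i → E i → EReal} {δ : Fin m → ℝ} {β : ℕ → Fin m → ℝ} {x : ℕ → PiLp 2 E}

theorem dom_block_eq_univ (hφ : ∀ i, LipschitzGradOnBounded (φ i)) (i : Fin m) (y : PiLp 2 E) :
    dom (block (φ i) i y) = Set.univ :=
  Set.eq_univ_of_forall fun _ => (hφ i).ne_top _

theorem differentiable_re_block (hφ : ∀ i, LipschitzGradOnBounded (φ i)) (i : Fin m)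
    (y : PiLp 2 E) : Differentiable ℝ (re (block (φ i) i y)) :=
  differentiable_block (hφ i).differentiable i y

theorem IsSequence.mem_feasible (hseq : IsSequence f X φ L l u δ β x) (n : ℕ) :
    x (n + 1) ∈ feasible X := by
  cases n with
  | zero => exact hseq.init_feasible
  | succ k => exact fun i => (hseq.update_mem k i).1

theorem IsSurrogate.ne_bot (hsurr : ∀ i, IsSurrogate (X i) (g i) (u i))
    (hproblem : Problem f g X) {i : Fin m} {s t : E i} (hs : s ∈ X i) (ht : t ∈ X i) :
    u i s t ≠ ⊥ := fun h =>
  hproblem.g_ne_bot i s (le_bot_iff.1 (h ▸ (hsurr i).major s hs t ht))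

theorem IsSequence.g_ne_top (hseq : IsSequence f X φ L l u δ β x)
    (hsurr : ∀ i, IsSurrogate (X i) (g i) (u i)) (k : ℕ) (i : Fin m) :
    g i (x (k + 2) i) ≠ ⊤ := fun h =>
  (hseq.update_mem k i).2.2 (top_le_iff.1 (h ▸ (hsurr i).major _ (hseq.mem_feasible (k + 1) i) _
    (hseq.mem_feasible k i)))

/-- Each block update satisfies the first-order optimality condition of its convex subproblem. -/
theorem IsSequence.optimality (hproblem : Problem f g X)
    (hsurr : ∀ i, IsSurrogate (X i) (g i) (u i)) (hu : ∀ i, SurrogateAssumption (X i) (g i) (u i))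
    (hseq : IsSequence f X φ L l u δ β x) (hφ : ∀ i, LipschitzGradOnBounded (φ i))
    (k : ℕ) (i : Fin m) {t : E i} (ht : t ∈ X i) :
    u i (x (k + 2) i) (x (k + 1) i) +
      ((-(smoothDeriv f φ L β x k i (t - x (k + 2) i)) : ℝ) : EReal) ≤ u i t (x (k + 1) i) := by
  have hp := hseq.mem_feasible k i
  have hS := hasFDerivAt_smooth (b := xbar β x k i) (L i (inter x (k + 1) i))
    (fderiv ℝ (block f i (inter x (k + 1) i)) (xbar β x k i))
    (differentiable_re_block hφ i (inter x (k + 1) i) (x (k + 2) i))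
  have h := le_of_isMin_add_convex ((hu i).convex _ hp)
    (fun t ht => IsSurrogate.ne_bot hsurr hproblem ht hp) (hseq.update_mem k i).1
    (hseq.update_mem k i).2.2 hS.differentiableAt
    (fun t ht => hseq.update_min k i t ht (by
      rw [kern, dom_block_eq_univ hφ]; exact Set.mem_univ t)) ht
  rw [hS.fderiv] at h
  exact h

/-- Descent in one block update. Finiteness of `g i` at the old block can fail only at the starting
point. -/
theorem IsSequence.block_decrease (hproblem : Problem f g X)
    (hsmooth : IsBlockRelSmooth f X φ L l)
    (hsurr : ∀ i, IsSurrogate (X i) (g i) (u i)) (hu : ∀ i, SurrogateAssumption (X i) (g i) (u i))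
    (hseq : IsSequence f X φ L l u δ β x) (hφ : ∀ i, LipschitzGradOnBounded (φ i))
    (k : ℕ) (i : Fin m) (hg : g i (x (k + 1) i) ≠ ⊤) :
    f (upd (inter x (k + 1) i) i (x (k + 2) i)) + (g i (x (k + 2) i)).toReal +
        stepDiv φ L x (k + 1) i ≤
      f (inter x (k + 1) i) + (g i (x (k + 1) i)).toReal + δ i * stepDiv φ L x k i := by
  set y := inter x (k + 1) i with hy
  have hrs := hsmooth.relSmooth i y ((hφ i).ne_top y)
  have hint : ∀ t, t ∈ interior (dom (block (φ i) i y)) := fun t => by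
    rw [dom_block_eq_univ hφ, interior_univ]; exact Set.mem_univ t
  have hp := hseq.mem_feasible k i
  have hv := hseq.mem_feasible (k + 1) i
  have hopt := hseq.optimality hproblem hsurr hu hφ k i hp
  rw [(hsurr i).diag _ hp] at hopt
  have hopt' := (add_le_add ((hsurr i).major _ hv _ hp) le_rfl).trans hopt
  rw [← EReal.coe_toReal hg (hproblem.g_ne_bot i _),
    ← EReal.coe_toReal (hseq.g_ne_top hsurr k i) (hproblem.g_ne_bot i _), ← EReal.coe_add,
    EReal.coe_le_coe_iff] at hopt'
  have hdec := BMME.block_decrease (hrs.upper (x (k + 2) i) (hint _) (xbar β x k i) (hint _))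
    (hrs.lower (x (k + 1) i) (hint _) (xbar β x k i) (hint _)) hopt'
  have hLl : 0 < L i y + l i y := add_pos_of_pos_of_nonneg hrs.L_pos hrs.l_nonneg
  have hext := mul_le_mul_of_nonneg_left (hseq.extrapolation k i) hLl.le
  have hext' : (L i y + l i y) * (δ i * L i (inter x k i) / (L i y + l i y) *
      bregman (kern φ x k i) (x k i) (x (k + 1) i)) = δ i * stepDiv φ L x k i := by
    rw [stepDiv]; field_simp
  rw [← hy, hext'] at hext
  have hself : block f i y (x (k + 1) i) = f y := by rw [block, hy, upd_inter_self]
  rw [hself] at hdec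
  exact hdec.trans (add_le_add le_rfl hext)

/-- Descent over one sweep. The divergences on the right belong to the previous sweep; since
`δ i < 1`, adding them to the objective gives a decreasing Lyapunov function. -/
theorem IsSequence.descent (hproblem : Problem f g X) (hsmooth : IsBlockRelSmooth f X φ L l)
    (hsurr : ∀ i, IsSurrogate (X i) (g i) (u i)) (hu : ∀ i, SurrogateAssumption (X i) (g i) (u i))
    (hseq : IsSequence f X φ L l u δ β x) (hφ : ∀ i, LipschitzGradOnBounded (φ i)) (k : ℕ) :
    objRe f g (x (k + 3)) + ∑ i, stepDiv φ L x (k + 2) i ≤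
      objRe f g (x (k + 2)) + ∑ i, δ i * stepDiv φ L x (k + 1) i := by
  have h1 := Finset.sum_le_sum fun i (_ : i ∈ Finset.univ) =>
    hseq.block_decrease hproblem hsmooth hsurr hu hφ (k + 1) i (hseq.g_ne_top hsurr k i)
  have h2 := sum_block_increments f x (k + 2)
  simp only [Finset.sum_add_distrib] at h1
  rw [Finset.sum_sub_distrib] at h2
  simp only [objRe]
  linarith

/-! ### Estimates on the bounded set containing the iterates -/

omit [∀ i, InnerProductSpace ℝ (E i)] in
theorem dist_succ_le_of_norm_le {R : ℝ} (hR : ∀ n, ‖x n‖ ≤ R) (n : ℕ) :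
    dist (x n) (x (n + 1)) ≤ 2 * R := by
  rw [dist_eq_norm]
  linarith [norm_sub_le (x n) (x (n + 1)), hR n, hR (n + 1)]

omit [∀ i, InnerProductSpace ℝ (E i)] in
theorem norm_inter_le_of_norm_le {R : ℝ} (hR : ∀ n, ‖x n‖ ≤ R) (n : ℕ) (i : Fin m) :
    ‖inter x n i‖ ≤ 3 * R := by
  have h1 := (norm_inter_sub_le x n i).trans (dist_succ_le_of_norm_le hR n)
  have h2 := norm_sub_norm_le (inter x n i) (x (n + 1))
  rw [norm_sub_rev] at h2
  linarith [hR (n + 1)]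

/-- A kernel whose gradient is Lipschitz on `B` has at most quadratic block divergences there. -/
theorem bregman_block_le {ψ : PiLp 2 E → EReal} (hψ : LipschitzGradOnBounded ψ)
    {B : Set (PiLp 2 E)} (hB : Convex ℝ B) {K : NNReal}
    (hK : LipschitzOnWith K (fderiv ℝ (re ψ)) B) {i : Fin m} {y : PiLp 2 E} {s t : E i}
    (hs : upd y i s ∈ B) (ht : upd y i t ∈ B) :
    bregman (block ψ i y) s t ≤ K * ‖s - t‖ ^ 2 :=
  bregman_le_of_lipschitz (q := block (re ψ) i y) (convex_preimage_upd y i hB)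
    (fun z _ => differentiable_block hψ.differentiable i y z)
    (fun _ hz _ hw => norm_fderiv_block_sub_le hψ.differentiable hK hz hw) K.coe_nonneg hs ht

/-- Eventually the step divergences are comparable to the squared steps. The factor `1 - δ i` is
kept in the lower bound: it is what one sweep gains. -/
theorem exists_stepDiv_bounds (hφ : ∀ i, LipschitzGradOnBounded (φ i))
    (hδ : ∀ i, δ i ∈ Set.Ioo (0 : ℝ) 1) (hbounds : EventualBounds φ L δ x)
    (hbdd : Bornology.IsBounded (Set.range x)) :
    ∃ N : ℕ, ∃ a > 0, ∃ c ≥ 0, ∃ Lmin > 0, ∃ Lmax, ∃ ρ > 0, ∀ k ≥ N,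
      a * dist (x (k + 1)) (x (k + 2)) ^ 2 ≤ ∑ i, (1 - δ i) * stepDiv φ L x (k + 1) i ∧
      ∀ i, 0 ≤ stepDiv φ L x (k + 1) i ∧
        stepDiv φ L x (k + 1) i ≤ c * ‖x (k + 1) i - x (k + 2) i‖ ^ 2 ∧
        Lmin ≤ L i (inter x (k + 1) i) ∧ L i (inter x (k + 1) i) ≤ Lmax ∧
        ∀ s t, ρ / 2 * ‖s - t‖ ^ 2 ≤ bregman (kern φ x (k + 1) i) s t := by
  obtain ⟨N, ⟨lo, hi, hL⟩, ρ, hρ, hstrong⟩ := hbounds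
  obtain ⟨R, hR0, hR⟩ : ∃ R > 0, ∀ n, ‖x n‖ ≤ R := by
    obtain ⟨R, hR0, hR⟩ := hbdd.exists_pos_norm_le
    exact ⟨R, hR0, fun n => hR _ (Set.mem_range_self n)⟩
  obtain ⟨Lmin, hLmin0, hLmin⟩ := exists_pos_forall_le fun i => (hL i).1
  obtain ⟨κ, hκ0, hκ⟩ := exists_pos_forall_le fun i => sub_pos.2 (hδ i).2
  obtain ⟨Lmax, hLmax0, hLmax⟩ := exists_nonneg_forall_le hi
  have hball : Bornology.IsBounded (Metric.closedBall (0 : PiLp 2 E) (5 * R)) :=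
    Metric.isBounded_closedBall
  choose K hK using fun i => (hφ i _ hball).2
  obtain ⟨Kmax, hKmax0, hKmax⟩ := exists_nonneg_forall_le fun i => (K i : ℝ)
  have hdist := dist_succ_le_of_norm_le hR
  have hinter := norm_inter_le_of_norm_le hR
  have hstr : ∀ k ≥ N, ∀ i s t,
      ρ / 2 * ‖s - t‖ ^ 2 ≤ bregman (kern φ x (k + 1) i) s t := fun k hk i s t => by
    have h := hstrong i k hk
    rw [kern, dom_block_eq_univ hφ] at h
    exact strongConvexOn_le_bregman h s t (differentiable_re_block hφ i _ t)
  have hlow : ∀ k ≥ N, ∀ i, Lmin * (ρ / 2 * ‖x (k + 1) i - x (k + 2) i‖ ^ 2) ≤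
      stepDiv φ L x (k + 1) i := fun k hk i => by
    refine mul_le_mul ((hLmin i).trans ((hL i).2.2.2 k hk).1) (hstr k hk i _ _) (by positivity) ?_
    exact (hL i).1.le.trans ((hL i).2.2.2 k hk).1
  refine ⟨N, κ * (Lmin * (ρ / 2)), by positivity, Lmax * Kmax, by positivity, Lmin, hLmin0, Lmax,
    ρ, hρ, fun k hk => ⟨?_, fun i => ⟨?_, ?_, ?_, ?_, hstr k hk i⟩⟩⟩
  · rw [dist_eq_norm, PiLp.norm_sq_eq_of_L2, Finset.mul_sum]
    refine Finset.sum_le_sum fun i _ => ?_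
    rw [mul_assoc, mul_assoc]
    exact mul_le_mul (hκ i) (hlow k hk i) (by positivity) (hκ0.le.trans (hκ i))
  · exact le_trans (by positivity) (hlow k hk i)
  · have hp : upd (inter x (k + 1) i) i (x (k + 1) i) ∈ Metric.closedBall 0 (5 * R) := by
      rw [upd_inter_self, mem_closedBall_zero_iff]
      linarith [hinter (k + 1) i]
    have hv : upd (inter x (k + 1) i) i (x (k + 2) i) ∈ Metric.closedBall 0 (5 * R) := by
      rw [mem_closedBall_zero_iff]
      have h1 := norm_upd_sub_upd (inter x (k + 1) i) i (x (k + 2) i) (x (k + 1) i)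
      rw [upd_inter_self] at h1
      have h2 := norm_sub_norm_le (upd (inter x (k + 1) i) i (x (k + 2) i)) (inter x (k + 1) i)
      have h3 := dist_apply_le (x (k + 2)) (x (k + 1)) i
      rw [dist_comm] at h3
      linarith [hinter (k + 1) i, hdist (k + 1)]
    have hup := bregman_block_le (hφ i) (convex_closedBall _ _) (hK i) hp hv
    rw [stepDiv, mul_assoc]
    refine mul_le_mul (((hL i).2.2.2 k hk).2.trans (hLmax i)) ?_ ?_ hLmax0
    · exact hup.trans (mul_le_mul_of_nonneg_right (hKmax i) (by positivity))
    · exact le_trans (by positivity) (hstr k hk i (x (k + 1) i) (x (k + 2) i))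
  · exact (hLmin i).trans ((hL i).2.2.2 k hk).1
  · exact ((hL i).2.2.2 k hk).2.trans (hLmax i)

end Descent

/-! ### Small subgradients along the iterates -/

section Subgradients

variable {m : ℕ} {E : Fin m → Type*} [∀ i, NormedAddCommGroup (E i)]
  [∀ i, InnerProductSpace ℝ (E i)] {f : PiLp 2 E → ℝ} {g : ∀ i, E i → EReal} {X : ∀ i, Set (E i)}
  {φ : Fin m → PiLp 2 E → EReal} {L l : Fin m → PiLp 2 E → ℝ}
  {u : ∀ i, E i → E i → EReal} {δ : Fin m → ℝ} {β : ℕ → Fin m → ℝ} {x : ℕ → PiLp 2 E}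

/-- The extrapolation condition bounds the extrapolation by the previous step: the divergence on
its left is at least quadratic by strong convexity, the one on its right at most quadratic. -/
theorem IsSequence.norm_sub_xbar_le (hsmooth : IsBlockRelSmooth f X φ L l)
    (hseq : IsSequence f X φ L l u δ β x) (hφ : ∀ i, LipschitzGradOnBounded (φ i))
    {k : ℕ} {i : Fin m} {Lmin ρ c : ℝ} (hLmin0 : 0 < Lmin) (hρ : 0 < ρ)
    (hdiv0 : 0 ≤ stepDiv φ L x k i)
    (hdiv : stepDiv φ L x k i ≤ c * ‖x k i - x (k + 1) i‖ ^ 2)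
    (hLmin : Lmin ≤ L i (inter x (k + 1) i))
    (hstrong : ∀ s t, ρ / 2 * ‖s - t‖ ^ 2 ≤ bregman (kern φ x (k + 1) i) s t) :
    ‖x (k + 1) i - xbar β x k i‖ ≤ √(2 * c / (ρ * Lmin)) * dist (x k) (x (k + 1)) := by
  have hl : 0 ≤ l i (inter x (k + 1) i) :=
    (hsmooth.relSmooth i _ ((hφ i).ne_top _)).l_nonneg
  have hL : 0 < L i (inter x (k + 1) i) + l i (inter x (k + 1) i) := by linarith
  have h1 := (hstrong _ _).trans (hseq.extrapolation k i)
  have h2 : δ i * L i (inter x k i) / (L i (inter x (k + 1) i) + l i (inter x (k + 1) i)) *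
      bregman (kern φ x k i) (x k i) (x (k + 1) i) =
      δ i * stepDiv φ L x k i / (L i (inter x (k + 1) i) + l i (inter x (k + 1) i)) := by
    rw [stepDiv]; ring
  rw [h2, le_div_iff₀ hL] at h1
  have h3 : δ i * stepDiv φ L x k i ≤ stepDiv φ L x k i :=
    mul_le_of_le_one_left hdiv0 (hseq.δ_mem i).2.le
  set e := ‖x (k + 1) i - xbar β x k i‖ with he
  set d := ‖x k i - x (k + 1) i‖ with hd
  have h4 : ρ / 2 * e ^ 2 * Lmin ≤
      ρ / 2 * e ^ 2 * (L i (inter x (k + 1) i) + l i (inter x (k + 1) i)) :=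
    mul_le_mul_of_nonneg_left (by linarith) (by positivity)
  have h5 : e ^ 2 ≤ 2 * c / (ρ * Lmin) * d ^ 2 := by
    rw [div_mul_eq_mul_div, le_div_iff₀ (by positivity)]
    linarith
  have h6 : e ≤ √(2 * c / (ρ * Lmin)) * d := by
    have hd0 : √(d ^ 2) = d := Real.sqrt_sq (norm_nonneg _)
    rw [← hd0, ← Real.sqrt_mul' _ (sq_nonneg d)]
    exact Real.le_sqrt_of_sq_le h5
  exact h6.trans (mul_le_mul_of_nonneg_left (dist_apply_le _ _ i) (Real.sqrt_nonneg _))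

/-- The gradient of the smooth part of a subproblem at its solution differs from the partial
gradient of `f` at the new iterate by a multiple of the last two steps. -/
theorem exists_norm_sub_smoothDeriv_le (hproblem : Problem f g X)
    (hsmooth : IsBlockRelSmooth f X φ L l)
    (hseq : IsSequence f X φ L l u δ β x) (hf_lip : LipschitzGradOnBounded fun y => (f y : EReal))
    (hφ : ∀ i, LipschitzGradOnBounded (φ i)) (hbounds : EventualBounds φ L δ x)
    (hbdd : Bornology.IsBounded (Set.range x)) :
    ∃ N : ℕ, ∃ C ≥ 0, ∀ k ≥ N, ∀ i,
      ‖(fderiv ℝ f (x (k + 2))).comp (blockIncl i).toContinuousLinearMap -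
        smoothDeriv f φ L β x k i‖ ≤
        C * (dist (x k) (x (k + 1)) + dist (x (k + 1)) (x (k + 2))) := by
  obtain ⟨N, _, _, c, hc, Lmin, hLmin0, Lmax, ρ, hρ, hN⟩ :=
    exists_stepDiv_bounds hφ hseq.δ_mem hbounds hbdd
  obtain ⟨R, hR0, hR⟩ : ∃ R > 0, ∀ n, ‖x n‖ ≤ R := by
    obtain ⟨R, hR0, hR⟩ := hbdd.exists_pos_norm_le
    exact ⟨R, hR0, fun n => hR _ (Set.mem_range_self n)⟩
  set C₁ := √(2 * c / (ρ * Lmin)) with hC₁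
  have hC₁0 : 0 ≤ C₁ := Real.sqrt_nonneg _
  have hball : Bornology.IsBounded (Metric.closedBall (0 : PiLp 2 E) ((5 + 2 * C₁) * R)) :=
    Metric.isBounded_closedBall
  choose K hK using fun i => (hφ i _ hball).2
  obtain ⟨Kf, hKf⟩ : ∃ K, LipschitzOnWith K (fderiv ℝ f) _ := (hf_lip _ hball).2
  obtain ⟨Kmax, hKmax0, hKmax⟩ := exists_nonneg_forall_le fun i => (K i : ℝ)
  refine ⟨N + 1, Kf * (C₁ + 1) + |Lmax| * Kmax * (C₁ + 1), by positivity, fun k hk i => ?_⟩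
  obtain ⟨j, rfl⟩ : ∃ j, k = j + 1 := ⟨k - 1, by omega⟩
  obtain ⟨hdiv0, hdiv, -, -, -⟩ := (hN j (by omega)).2 i
  obtain ⟨-, -, hLlo, hLhi, hstrong⟩ := (hN (j + 1) (by omega)).2 i
  have hb := hseq.norm_sub_xbar_le hsmooth hφ hLmin0 hρ hdiv0 hdiv hLlo hstrong
  rw [← hC₁] at hb
  set k := j + 1 with hkdef
  set y := inter x (k + 1) i with hy
  set b := xbar β x k i with hbdef
  set d := dist (x k) (x (k + 1)) with hd
  set d' := dist (x (k + 1)) (x (k + 2)) with hd'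
  have hd0 : 0 ≤ d := dist_nonneg
  have hd'0 : 0 ≤ d' := dist_nonneg
  have hyR : ‖y‖ ≤ 3 * R := norm_inter_le_of_norm_le hR (k + 1) i
  have hdR : d ≤ 2 * R := dist_succ_le_of_norm_le hR k
  have hdR' : d' ≤ 2 * R := dist_succ_le_of_norm_le hR (k + 1)
  have hCR : 0 ≤ C₁ * R := by positivity
  have hv : ‖x (k + 1) i - x (k + 2) i‖ ≤ d' := dist_apply_le _ _ i
  have hyb : ‖y - upd y i b‖ ≤ C₁ * d := by
    have h1 := norm_upd_sub_upd y i (x (k + 1) i) b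
    rw [hy, upd_inter_self, ← hy] at h1
    rwa [h1]
  have hyv : ‖y - upd y i (x (k + 2) i)‖ ≤ d' := by
    have h1 := norm_upd_sub_upd y i (x (k + 1) i) (x (k + 2) i)
    rw [hy, upd_inter_self, ← hy] at h1
    rwa [h1]
  have hmemb : upd y i b ∈ Metric.closedBall 0 ((5 + 2 * C₁) * R) := by
    rw [mem_closedBall_zero_iff]
    have h1 := norm_sub_norm_le (upd y i b) y
    rw [norm_sub_rev] at h1
    have h2 : C₁ * d ≤ C₁ * (2 * R) := mul_le_mul_of_nonneg_left hdR hC₁0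
    linarith
  have hmemv : upd y i (x (k + 2) i) ∈ Metric.closedBall 0 ((5 + 2 * C₁) * R) := by
    rw [mem_closedBall_zero_iff]
    have h1 := norm_sub_norm_le (upd y i (x (k + 2) i)) y
    rw [norm_sub_rev] at h1
    linarith
  have hmemz : x (k + 2) ∈ Metric.closedBall 0 ((5 + 2 * C₁) * R) := by
    rw [mem_closedBall_zero_iff]
    linarith [hR (k + 2)]
  have hf1 := norm_fderiv_comp_sub_fderiv_block_le
    (hproblem.f_contDiff.differentiable one_ne_zero) hKf hmemz hmemb
  have hzb : dist (x (k + 2)) (upd y i b) ≤ (C₁ + 1) * (d + d') := by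
    have h1 := norm_inter_sub_le x (k + 1) i
    rw [← dist_eq_norm] at h1
    have h2 := dist_triangle (x (k + 2)) y (upd y i b)
    rw [dist_eq_norm y] at h2
    have h3 : dist (x (k + 2)) y ≤ d' := h1
    have h4 : 0 ≤ C₁ * d' := by positivity
    linarith
  have hre : re (kern φ x (k + 1) i) = block (re (φ i)) i y := rfl
  have hq1 : ‖fderiv ℝ (re (kern φ x (k + 1) i)) (x (k + 2) i) -
      fderiv ℝ (re (kern φ x (k + 1) i)) b‖ ≤ K i * ‖x (k + 2) i - b‖ := by
    rw [hre]
    exact norm_fderiv_block_sub_le (hφ i).differentiable (hK i) hmemv hmemb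
  have hvb : ‖x (k + 2) i - b‖ ≤ (C₁ + 1) * (d + d') := by
    have h1 := norm_sub_le_norm_sub_add_norm_sub (x (k + 2) i) (x (k + 1) i) b
    rw [norm_sub_rev (x (k + 2) i) (x (k + 1) i)] at h1
    have h4 : 0 ≤ C₁ * d' := by positivity
    linarith
  have hsplit : (fderiv ℝ f (x (k + 2))).comp (blockIncl i).toContinuousLinearMap -
      smoothDeriv f φ L β x k i =
      ((fderiv ℝ f (x (k + 2))).comp (blockIncl i).toContinuousLinearMap -
        fderiv ℝ (block f i y) b) -
      L i y • (fderiv ℝ (re (kern φ x (k + 1) i)) (x (k + 2) i) -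
        fderiv ℝ (re (kern φ x (k + 1) i)) b) := by
    rw [smoothDeriv]; abel
  have hLabs : |L i y| ≤ |Lmax| := abs_le_abs_of_nonneg (hLmin0.le.trans hLlo) hLhi
  have hterm : ‖L i y • (fderiv ℝ (re (kern φ x (k + 1) i)) (x (k + 2) i) -
        fderiv ℝ (re (kern φ x (k + 1) i)) b)‖ ≤ |Lmax| * (Kmax * ((C₁ + 1) * (d + d'))) := by
    rw [norm_smul, Real.norm_eq_abs]
    exact mul_le_mul hLabs (hq1.trans (mul_le_mul (hKmax i) hvb (norm_nonneg _) hKmax0))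
      (norm_nonneg _) (abs_nonneg _)
  have hf2 := hf1.trans (mul_le_mul_of_nonneg_left hzb Kf.coe_nonneg)
  have htri := (norm_sub_le _ _).trans (add_le_add hf2 hterm)
  rw [← hsplit] at htri
  refine htri.trans (le_of_eq ?_)
  ring

variable [∀ i, CompleteSpace (E i)]

/-- Every subproblem yields a subgradient of its convex part at the new block, close to the
negative partial gradient of `f`. -/
theorem exists_subgradient_surrogate (hproblem : Problem f g X)
    (hsmooth : IsBlockRelSmooth f X φ L l) (hsurr : ∀ i, IsSurrogate (X i) (g i) (u i))
    (hu : ∀ i, SurrogateAssumption (X i) (g i) (u i))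
    (hseq : IsSequence f X φ L l u δ β x) (hf_lip : LipschitzGradOnBounded fun y => (f y : EReal))
    (hφ : ∀ i, LipschitzGradOnBounded (φ i)) (hbounds : EventualBounds φ L δ x)
    (hbdd : Bornology.IsBounded (Set.range x)) :
    ∃ N : ℕ, ∃ C ≥ 0, ∀ k ≥ N, ∀ i, ∃ s : E i,
      (∀ t ∈ X i, u i (x (k + 2) i) (x (k + 1) i) +
        ((inner ℝ s (t - x (k + 2) i) : ℝ) : EReal) ≤ u i t (x (k + 1) i)) ∧
      ‖(gradient f (x (k + 2))) i + s‖ ≤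
        C * (dist (x k) (x (k + 1)) + dist (x (k + 1)) (x (k + 2))) := by
  obtain ⟨N, C, hC, h⟩ :=
    exists_norm_sub_smoothDeriv_le hproblem hsmooth hseq hf_lip hφ hbounds hbdd
  refine ⟨N, C, hC, fun k hk i =>
    ⟨-(InnerProductSpace.toDual ℝ (E i)).symm (smoothDeriv f φ L β x k i), fun t ht => ?_, ?_⟩⟩
  · rw [inner_neg_left, InnerProductSpace.toDual_symm_apply]
    exact hseq.optimality hproblem hsurr hu hφ k i ht
  · rw [gradient_apply_eq, ← sub_eq_add_neg, ← map_sub, LinearIsometryEquiv.norm_map]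
    exact h k hk i

/-- `Φ` has limiting subgradients at the iterates that are bounded by the last two steps. -/
theorem exists_limSubdiff_Phi_norm_le (hproblem : Problem f g X)
    (hsmooth : IsBlockRelSmooth f X φ L l) (hsurr : ∀ i, IsSurrogate (X i) (g i) (u i))
    (hu : ∀ i, SurrogateAssumption (X i) (g i) (u i))
    (hseq : IsSequence f X φ L l u δ β x) (hf_lip : LipschitzGradOnBounded fun y => (f y : EReal))
    (hφ : ∀ i, LipschitzGradOnBounded (φ i)) (hbounds : EventualBounds φ L δ x)
    (hbdd : Bornology.IsBounded (Set.range x))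
    (hclose : ∀ i, SubgradientsClose (X i) (g i) (u i)) :
    ∃ N : ℕ, ∃ C ≥ 0, ∀ k ≥ N, ∃ w ∈ limSubdiff (Phi f g X) (x (k + 2)),
      ‖w‖ ≤ C * (dist (x k) (x (k + 1)) + dist (x (k + 1)) (x (k + 2))) := by
  obtain ⟨N, C, hC, hs⟩ := exists_subgradient_surrogate hproblem hsmooth hsurr hu hseq hf_lip hφ
    hbounds hbdd
  have hblock : ∀ i, Bornology.IsBounded (Set.range fun n => x (n + 1) i) := fun i => by
    obtain ⟨R, hR⟩ := hbdd.exists_norm_le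
    refine isBounded_iff_forall_norm_le.2 ⟨R, ?_⟩
    rintro _ ⟨n, rfl⟩
    exact (PiLp.norm_apply_le _ i).trans (hR _ (Set.mem_range_self _))
  choose A hA using fun i => hclose i _
    (Set.range_subset_iff.2 fun n => hseq.mem_feasible n i) (hblock i)
  obtain ⟨Amax, hAmax0, hAmax⟩ := exists_nonneg_forall_le A
  refine ⟨N, m * (C + Amax), by positivity, fun k hk => ?_⟩
  choose s hs1 hs2 using hs k hk
  have hp := hseq.mem_feasible k
  have hv := hseq.mem_feasible (k + 1)
  have hmem : ∀ i, s i ∈ limSubdiff (addIndicator (X i) fun z => u i z (x (k + 1) i))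
      (x (k + 2) i) := fun i => by
    have hval : addIndicator (X i) (fun z => u i z (x (k + 1) i)) (x (k + 2) i) =
        u i (x (k + 2) i) (x (k + 1) i) := if_pos (hv i)
    refine mem_limSubdiff_of_forall_le ?_ ?_ fun t => ?_
    · rw [hval]; exact (hseq.update_mem k i).2.2
    · rw [hval]; exact IsSurrogate.ne_bot hsurr hproblem (hv i) (hp i)
    · by_cases ht : t ∈ X i
      · rw [hval]
        exact (hs1 i t ht).trans_eq (if_pos ht).symm
      · exact le_top.trans_eq (if_neg ht).symm
  choose w hw1 hw2 using fun i => hA i (x (k + 2) i) ⟨k + 1, rfl⟩ (x (k + 1) i) ⟨k, rfl⟩ _ (hmem i)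
  refine ⟨gradient f (x (k + 2)) + WithLp.toLp 2 w, ?_, ?_⟩
  · rw [Phi_eq_add_sum hproblem.g_ne_bot]
    exact gradient_add_mem_limSubdiff hproblem.f_contDiff hw1
  · rw [mul_assoc]
    refine norm_le_of_forall_le fun i => ?_
    have h1 : (gradient f (x (k + 2)) + WithLp.toLp 2 w) i =
        ((gradient f (x (k + 2))) i + s i) + (w i - s i) := by
      change (gradient f (x (k + 2))) i + w i = _
      abel
    rw [h1, add_mul]
    refine (norm_add_le _ _).trans (add_le_add (hs2 i) ((hw2 i).trans ?_))
    refine mul_le_mul (hAmax i) ?_ (norm_nonneg _) hAmax0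
    have h2 := dist_apply_le (x (k + 2)) (x (k + 1)) i
    rw [dist_comm] at h2
    exact h2.trans (le_add_of_nonneg_left dist_nonneg)

end Subgradients

/-! ### Cluster points and convergence -/

section Cluster

variable {m : ℕ} {E : Fin m → Type*} [∀ i, NormedAddCommGroup (E i)]
  [∀ i, InnerProductSpace ℝ (E i)] {f : PiLp 2 E → ℝ} {g : ∀ i, E i → EReal} {X : ∀ i, Set (E i)}
  {φ : Fin m → PiLp 2 E → EReal} {L l : Fin m → PiLp 2 E → ℝ}
  {u : ∀ i, E i → E i → EReal} {δ : Fin m → ℝ} {β : ℕ → Fin m → ℝ} {x : ℕ → PiLp 2 E}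

/-- The real Lyapunov function: the objective plus the damped divergences of the last sweep. -/
noncomputable def lyapunov (f : PiLp 2 E → ℝ) (g : ∀ i, E i → EReal)
    (φ : Fin m → PiLp 2 E → EReal) (L : Fin m → PiLp 2 E → ℝ) (δ : Fin m → ℝ)
    (x : ℕ → PiLp 2 E) (k : ℕ) : ℝ :=
  objRe f g (x (k + 1)) + ∑ i, δ i * stepDiv φ L x k i

theorem Phi_eq_coe_objRe (hproblem : Problem f g X) {y : PiLp 2 E} (hy : y ∈ feasible X)
    (hg : ∀ i, g i (y i) ≠ ⊤) : Phi f g X y = (objRe f g y : EReal) := by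
  have h1 : Phi f g X y = objective f g y := if_pos hy
  rw [h1, objective, objRe, EReal.coe_add,
    sum_eq_coe_sum_toReal _ (fun i _ => hproblem.g_ne_bot i _) (fun i _ => hg i)]

theorem IsSequence.Phi_eq (hproblem : Problem f g X)
    (hsurr : ∀ i, IsSurrogate (X i) (g i) (u i)) (hseq : IsSequence f X φ L l u δ β x) (k : ℕ) :
    Phi f g X (x (k + 2)) = (objRe f g (x (k + 2)) : EReal) :=
  Phi_eq_coe_objRe hproblem (hseq.mem_feasible (k + 1)) (hseq.g_ne_top hsurr k)

/-- The steps vanish, and the objective and the Lyapunov function have the same limit. -/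
theorem exists_tendsto_lyapunov (hproblem : Problem f g X) (hsmooth : IsBlockRelSmooth f X φ L l)
    (hsurr : ∀ i, IsSurrogate (X i) (g i) (u i)) (hu : ∀ i, SurrogateAssumption (X i) (g i) (u i))
    (hseq : IsSequence f X φ L l u δ β x) (hφ : ∀ i, LipschitzGradOnBounded (φ i))
    (hbounds : EventualBounds φ L δ x) (hbdd : Bornology.IsBounded (Set.range x)) :
    ∃ N : ℕ, ∃ a > 0, ∃ c ≥ 0, ∃ Fs : ℝ,
      (∀ k ≥ N, a * dist (x (k + 1)) (x (k + 2)) ^ 2 ≤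
        lyapunov f g φ L δ x k - lyapunov f g φ L δ x (k + 1)) ∧
      (∀ k ≥ N, objRe f g (x (k + 1)) ≤ lyapunov f g φ L δ x k ∧
        lyapunov f g φ L δ x k ≤ objRe f g (x (k + 1)) + c * dist (x k) (x (k + 1)) ^ 2) ∧
      Tendsto (fun k => dist (x k) (x (k + 1))) atTop (𝓝 0) ∧
      Tendsto (lyapunov f g φ L δ x) atTop (𝓝 Fs) ∧
      Tendsto (fun k => objRe f g (x k)) atTop (𝓝 Fs) := by
  obtain ⟨N, a, ha, c, hc, _, _, _, _, _, hN⟩ :=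
    exists_stepDiv_bounds hφ hseq.δ_mem hbounds hbdd
  have hdec : ∀ k ≥ N + 1, a * dist (x (k + 1)) (x (k + 2)) ^ 2 ≤
      lyapunov f g φ L δ x k - lyapunov f g φ L δ x (k + 1) := fun k hk => by
    obtain ⟨j, rfl⟩ : ∃ j, k = j + 1 := ⟨k - 1, by omega⟩
    have h1 := hseq.descent hproblem hsmooth hsurr hu hφ j
    have h2 := (hN (j + 1) (by omega)).1
    simp only [sub_mul, one_mul, Finset.sum_sub_distrib] at h2
    simp only [lyapunov]
    linarith
  have hFH : ∀ k ≥ N + 1, objRe f g (x (k + 1)) ≤ lyapunov f g φ L δ x k ∧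
      lyapunov f g φ L δ x k ≤ objRe f g (x (k + 1)) + c * dist (x k) (x (k + 1)) ^ 2 := by
    intro k hk
    obtain ⟨j, rfl⟩ : ∃ j, k = j + 1 := ⟨k - 1, by omega⟩
    have h1 := (hN j (by omega)).2
    refine ⟨le_add_of_nonneg_right (Finset.sum_nonneg fun i _ =>
      mul_nonneg (hseq.δ_mem i).1.le (h1 i).1), add_le_add le_rfl ?_⟩
    rw [dist_eq_norm, PiLp.norm_sq_eq_of_L2, Finset.mul_sum]
    exact Finset.sum_le_sum fun i _ =>
      (mul_le_of_le_one_left (h1 i).1 (hseq.δ_mem i).2.le).trans (h1 i).2.1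
  obtain ⟨b, hb⟩ := hproblem.bddBelow
  have hlow : ∀ k, b ≤ objRe f g (x (k + 2)) := fun k => by
    have h1 := hb _ (hseq.mem_feasible (k + 1))
    have h2 : Phi f g X (x (k + 2)) = objective f g (x (k + 2)) := if_pos (hseq.mem_feasible _)
    rw [← h2, hseq.Phi_eq hproblem hsurr k] at h1
    exact EReal.coe_le_coe_iff.1 h1
  -- the Lyapunov function is monotone and bounded below from index `N + 1` on
  set H : ℕ → ℝ := fun n => lyapunov f g φ L δ x (n + (N + 1)) with hH
  have hanti : Antitone H := antitone_nat_of_succ_le fun n => by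
    have h1 := hdec (n + (N + 1)) (by omega)
    have h2 : 0 ≤ a * dist (x (n + (N + 1) + 1)) (x (n + (N + 1) + 2)) ^ 2 := by positivity
    have h3 : H (n + 1) = lyapunov f g φ L δ x (n + (N + 1) + 1) :=
      congrArg (lyapunov f g φ L δ x) (by omega)
    have h4 : H n = lyapunov f g φ L δ x (n + (N + 1)) := rfl
    linarith
  have hbelow : BddBelow (Set.range H) := by
    refine ⟨b, ?_⟩
    rintro _ ⟨n, rfl⟩
    exact (hlow (n + N)).trans (hFH (n + (N + 1)) (by omega)).1
  have hHlim : Tendsto (lyapunov f g φ L δ x) atTop (𝓝 (⨅ n, H n)) :=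
    (tendsto_add_atTop_iff_nat (N + 1)).1 (tendsto_atTop_ciInf hanti hbelow)
  have hstep : Tendsto (fun k => dist (x k) (x (k + 1))) atTop (𝓝 0) := by
    have h1 : Tendsto (fun k => lyapunov f g φ L δ x k - lyapunov f g φ L δ x (k + 1)) atTop
        (𝓝 0) := by
      simpa using hHlim.sub ((tendsto_add_atTop_iff_nat 1).2 hHlim)
    have h2 : Tendsto (fun k => √((lyapunov f g φ L δ x k - lyapunov f g φ L δ x (k + 1)) / a))
        atTop (𝓝 0) := by simpa using (h1.div_const a).sqrt
    refine (tendsto_add_atTop_iff_nat 1).1 (squeeze_zero' (Eventually.of_forall fun _ =>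
      dist_nonneg) ?_ h2)
    filter_upwards [eventually_ge_atTop (N + 1)] with k hk
    refine Real.le_sqrt_of_sq_le ?_
    rw [le_div_iff₀ ha]
    linarith [hdec k hk]
  refine ⟨N + 1, a, ha, c, hc, ⨅ n, H n, hdec, hFH, hstep, hHlim, ?_⟩
  have h1 : Tendsto (fun k => lyapunov f g φ L δ x k - c * dist (x k) (x (k + 1)) ^ 2) atTop
      (𝓝 (⨅ n, H n)) := by
    simpa using hHlim.sub ((hstep.pow 2).const_mul c)
  refine (tendsto_add_atTop_iff_nat 1).1 (tendsto_of_tendsto_of_tendsto_of_le_of_le' h1 hHlim ?_ ?_)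
  · filter_upwards [eventually_ge_atTop (N + 1)] with k hk
    linarith [(hFH k hk).2]
  · filter_upwards [eventually_ge_atTop (N + 1)] with k hk using (hFH k hk).1

variable [∀ i, CompleteSpace (E i)]

/-- Along a convergent subsequence the values of each `g i` converge to the value at the limit:
from below by semicontinuity, from above because the new block competes with the limit in the
subproblem, and `u i` is continuous in its second variable. -/
theorem tendsto_g_of_tendsto (hproblem : Problem f g X)
    (hsmooth : IsBlockRelSmooth f X φ L l) (hsurr : ∀ i, IsSurrogate (X i) (g i) (u i))
    (hu : ∀ i, SurrogateAssumption (X i) (g i) (u i))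
    (hseq : IsSequence f X φ L l u δ β x) (hf_lip : LipschitzGradOnBounded fun y => (f y : EReal))
    (hφ : ∀ i, LipschitzGradOnBounded (φ i)) (hbounds : EventualBounds φ L δ x)
    (hbdd : Bornology.IsBounded (Set.range x))
    (hstep : Tendsto (fun k => dist (x k) (x (k + 1))) atTop (𝓝 0))
    {ψ : ℕ → ℕ} (hψ : Tendsto ψ atTop atTop) {xs : PiLp 2 E} (hxs : xs ∈ feasible X)
    (hp : Tendsto (fun j => x (ψ j + 1)) atTop (𝓝 xs))
    (hv : Tendsto (fun j => x (ψ j + 2)) atTop (𝓝 xs)) (i : Fin m) :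
    Tendsto (fun j => g i (x (ψ j + 2) i)) atTop (𝓝 (g i (xs i))) := by
  obtain ⟨N, C, hC, hs⟩ := exists_subgradient_surrogate hproblem hsmooth hsurr hu hseq hf_lip hφ
    hbounds hbdd
  have hproj : Tendsto (fun y : PiLp 2 E => y i) (𝓝 xs) (𝓝 (xs i)) :=
    (PiLp.continuous_apply 2 E i).tendsto xs
  have hpi := hproj.comp hp
  have hvi := hproj.comp hv
  set e : ℕ → ℝ := fun j => (C * (dist (x (ψ j)) (x (ψ j + 1)) +
    dist (x (ψ j + 1)) (x (ψ j + 2))) + ‖gradient f (x (ψ j + 2))‖) * ‖xs i - x (ψ j + 2) i‖ with he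
  have he0 : Tendsto e atTop (𝓝 0) := by
    have h1 := ((hstep.comp hψ).add
      (hstep.comp ((tendsto_add_atTop_nat 1).comp hψ))).const_mul C
    have h2 := (((continuous_gradient hproblem.f_contDiff).tendsto xs).comp hv).norm
    have h3 := (tendsto_const_nhds (x := xs i)).sub hvi
    simpa using (h1.add h2).mul h3.norm
  have hupper : ∀ᶠ j in atTop, g i (x (ψ j + 2) i) ≤
      u i (xs i) (x (ψ j + 1) i) + ((e j : ℝ) : EReal) := by
    filter_upwards [hψ.eventually_ge_atTop N] with j hj
    obtain ⟨s, hs1, hs2⟩ := hs (ψ j) hj i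
    have h1 := (add_le_add ((hsurr i).major _ (hseq.mem_feasible (ψ j + 1) i) _
      (hseq.mem_feasible (ψ j) i)) le_rfl).trans (hs1 (xs i) (hxs i))
    have hnorm : ‖s‖ ≤ C * (dist (x (ψ j)) (x (ψ j + 1)) +
        dist (x (ψ j + 1)) (x (ψ j + 2))) + ‖gradient f (x (ψ j + 2))‖ := by
      have h2 : s = ((gradient f (x (ψ j + 2))) i + s) - (gradient f (x (ψ j + 2))) i := by abel
      rw [h2]
      exact (norm_sub_le _ _).trans (add_le_add hs2 (PiLp.norm_apply_le _ i))
    have h3 : -inner ℝ s (xs i - x (ψ j + 2) i) ≤ e j :=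
      (neg_le_abs _).trans ((abs_real_inner_le_norm _ _).trans
        (mul_le_mul_of_nonneg_right hnorm (norm_nonneg _)))
    have h4 := add_le_add h1 (EReal.coe_le_coe_iff.2 h3)
    rwa [add_assoc, ← EReal.coe_add, add_neg_cancel, EReal.coe_zero, add_zero] at h4
  have hlim : Tendsto (fun j => u i (xs i) (x (ψ j + 1) i) + ((e j : ℝ) : EReal)) atTop
      (𝓝 (g i (xs i))) := by
    have h1 : Tendsto (fun j => u i (xs i) (x (ψ j + 1) i)) atTop (𝓝 (g i (xs i))) := by
      rw [← (hsurr i).diag _ (hxs i)]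
      exact ((hu i).cont _ (hxs i) _ (hxs i)).tendsto.comp (tendsto_nhdsWithin_iff.2
        ⟨hpi, Eventually.of_forall fun j => hseq.mem_feasible (ψ j) i⟩)
    have h2 : Tendsto (fun j => ((e j : ℝ) : EReal)) atTop (𝓝 ((0 : ℝ) : EReal)) :=
      EReal.tendsto_coe.2 he0
    have h3 := (EReal.continuousAt_add (p := (g i (xs i), ((0 : ℝ) : EReal)))
      (Or.inr (EReal.coe_ne_bot _)) (Or.inr (EReal.coe_ne_top _))).tendsto.comp (h1.prodMk_nhds h2)
    simpa [Function.comp_def] using h3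
  refine tendsto_order.2 ⟨fun b hb => hvi.eventually (hproblem.g_lsc i (xs i) b hb),
    fun b hb => ?_⟩
  filter_upwards [hupper, (tendsto_order.1 hlim).2 b hb] with j h1 h2 using h1.trans_lt h2

/-- The limit of a convergent subsequence has a finite value, which is the limit of the values. -/
theorem Phi_eq_of_tendsto (hproblem : Problem f g X)
    (hsmooth : IsBlockRelSmooth f X φ L l) (hsurr : ∀ i, IsSurrogate (X i) (g i) (u i))
    (hu : ∀ i, SurrogateAssumption (X i) (g i) (u i))
    (hseq : IsSequence f X φ L l u δ β x) (hf_lip : LipschitzGradOnBounded fun y => (f y : EReal))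
    (hφ : ∀ i, LipschitzGradOnBounded (φ i)) (hbounds : EventualBounds φ L δ x)
    (hbdd : Bornology.IsBounded (Set.range x))
    (hstep : Tendsto (fun k => dist (x k) (x (k + 1))) atTop (𝓝 0))
    {Fs : ℝ} (hF : Tendsto (fun k => objRe f g (x k)) atTop (𝓝 Fs))
    {ψ : ℕ → ℕ} (hψ : Tendsto ψ atTop atTop) {xs : PiLp 2 E}
    (hp : Tendsto (fun j => x (ψ j + 1)) atTop (𝓝 xs))
    (hv : Tendsto (fun j => x (ψ j + 2)) atTop (𝓝 xs)) :
    Phi f g X xs = (Fs : EReal) := by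
  have hxs : xs ∈ feasible X := fun i =>
    (hproblem.X_closed i).mem_of_tendsto (((PiLp.continuous_apply 2 E i).tendsto xs).comp hv)
      (Eventually.of_forall fun j => hseq.mem_feasible (ψ j + 1) i)
  have hψ2 : Tendsto (fun j => ψ j + 2) atTop atTop := (tendsto_add_atTop_nat 2).comp hψ
  have hg := tendsto_g_of_tendsto hproblem hsmooth hsurr hu hseq hf_lip hφ hbounds hbdd hstep hψ
    hxs hp hv
  have hfv := (hproblem.f_contDiff.continuous.tendsto xs).comp hv
  have hGlim : Tendsto (fun j => ∑ i, (g i (x (ψ j + 2) i)).toReal) atTop (𝓝 (Fs - f xs)) := by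
    refine ((hF.comp hψ2).sub hfv).congr fun j => ?_
    simp [objRe]
  have hfin : ∀ i, g i (xs i) ≠ ⊤ := by
    intro i hi
    have htop : ∑ i, g i (xs i) = ⊤ :=
      sum_eq_top (fun j _ => hproblem.g_ne_bot j _) (Finset.mem_univ i) hi
    have hlsc : LowerSemicontinuousAt (fun z : PiLp 2 E => ∑ i, g i (z i)) xs :=
      lowerSemicontinuousAt_sum_ereal _ (fun j _ => ((hproblem.g_lsc j).comp
        (PiLp.continuous_apply 2 E j)) xs) fun j _ => hproblem.g_ne_bot j _
    have h1 := hv.eventually (hlsc ((Fs - f xs + 1 : ℝ) : EReal) (by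
      simp only [htop]; exact EReal.coe_lt_top _))
    have h2 := hGlim.eventually (gt_mem_nhds (show Fs - f xs < Fs - f xs + 1 by linarith))
    obtain ⟨j, hj1, hj2⟩ := (h1.and h2).exists
    simp only [gt_iff_lt] at hj1
    rw [sum_eq_coe_sum_toReal _ (fun i _ => hproblem.g_ne_bot i _)
      (fun i _ => hseq.g_ne_top hsurr (ψ j) i), EReal.coe_lt_coe_iff] at hj1
    linarith
  have hobj : Tendsto (fun j => objRe f g (x (ψ j + 2))) atTop (𝓝 (objRe f g xs)) :=
    hfv.add (tendsto_finsetSum _ fun i _ =>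
      (EReal.tendsto_toReal (hfin i) (hproblem.g_ne_bot i _)).comp (hg i))
  rw [Phi_eq_coe_objRe hproblem hxs hfin, tendsto_nhds_unique (hF.comp hψ2) hobj]

end Cluster

end BMME

theorem theorem4p2 {m : ℕ} {E : Fin m → Type*} [∀ i, NormedAddCommGroup (E i)]
    [∀ i, InnerProductSpace ℝ (E i)] [∀ i, FiniteDimensional ℝ (E i)]
    (f : PiLp 2 E → ℝ) (g : ∀ i, E i → EReal) (X : ∀ i, Set (E i))
    (φ : Fin m → PiLp 2 E → EReal) (L l : Fin m → PiLp 2 E → ℝ)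
    (u : ∀ i, E i → E i → EReal) (δ : Fin m → ℝ) (β : ℕ → Fin m → ℝ) (x : ℕ → PiLp 2 E)
    (hproblem : BMME.Problem f g X)
    (hsmooth : BMME.IsBlockRelSmooth f X φ L l)
    (hsurr : ∀ i, BMME.IsSurrogate (X i) (g i) (u i))
    (hseq : BMME.IsSequence f X φ L l u δ β x)
    (hinterior : ∀ n i, x n ∈ interior (BMME.dom (φ i)))
    (hu : ∀ i, BMME.SurrogateAssumption (X i) (g i) (u i))
    (hbounds : BMME.EventualBounds φ L δ x)
    (hf_lip : BMME.LipschitzGradOnBounded (fun y => (f y : EReal)))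
    (hφ_lip : ∀ i, BMME.LipschitzGradOnBounded (φ i))
    (hbdd : Bornology.IsBounded (Set.range x))
    (hclose : ∀ i, BMME.SubgradientsClose (X i) (g i) (u i))
    (hKL : ∀ y, (BMME.limSubdiff (BMME.Phi f g X) y).Nonempty → BMME.KLAt (BMME.Phi f g X) y) :
    ∃ xstar : PiLp 2 E, Tendsto x atTop (𝓝 xstar) ∧ BMME.IsCritical (BMME.Phi f g X) xstar := by
  have : ∀ i, CompleteSpace (E i) := fun i => FiniteDimensional.complete ℝ (E i)
  have : ∀ i, ProperSpace (E i) := fun i => FiniteDimensional.proper ℝ (E i)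
  have : ProperSpace (PiLp 2 E) := FiniteDimensional.proper ℝ (PiLp 2 E)
  obtain ⟨N₁, a, ha, c, hc, Fs, hdec, hFH, hstep, hHlim, hFlim⟩ :=
    BMME.exists_tendsto_lyapunov hproblem hsmooth hsurr hu hseq hφ_lip hbounds hbdd
  obtain ⟨N₂, C, hC, hw⟩ := BMME.exists_limSubdiff_Phi_norm_le hproblem hsmooth hsurr hu hseq
    hf_lip hφ_lip hbounds hbdd hclose
  -- `hdec` and `hFH` hold from `N₁` on, `hw` from `N₂` on; `xs` is a cluster point
  obtain ⟨xs, -, ψ, hψ, hψlim⟩ := tendsto_subseq_of_bounded hbdd fun n => Set.mem_range_self n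
  have hψtop := hψ.tendsto_atTop
  -- neighbouring iterates share the limit of the subsequence
  have hnext : ∀ {χ : ℕ → ℕ}, Tendsto χ atTop atTop → Tendsto (fun j => x (χ j)) atTop (𝓝 xs) →
      Tendsto (fun j => x (χ j + 1)) atTop (𝓝 xs) := fun hχ h =>
    h.congr_dist (hstep.comp hχ)
  have hp := hnext hψtop hψlim
  have hv := hnext ((tendsto_add_atTop_nat 1).comp hψtop) hp
  have hPhi := BMME.Phi_eq_of_tendsto hproblem hsmooth hsurr hu hseq hf_lip hφ_lip hbounds hbdd
    hstep hFlim hψtop hp hv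
  have hcrit : (0 : PiLp 2 E) ∈ BMME.limSubdiff (BMME.Phi f g X) xs := by
    choose! w hw1 hw2 using hw
    have hψN : Tendsto (fun j => ψ (j + N₂)) atTop atTop :=
      hψtop.comp (tendsto_add_atTop_nat N₂)
    have hge : ∀ j, N₂ ≤ ψ (j + N₂) := fun j =>
      (Nat.le_add_left N₂ j).trans (hψ.le_apply)
    refine BMME.mem_limSubdiff_of_tendsto (xs := fun j => x (ψ (j + N₂) + 2))
      (vs := fun j => w (ψ (j + N₂))) ?_ ?_ (hv.comp (tendsto_add_atTop_nat N₂)) ?_ ?_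
      fun j => hw1 _ (hge j)
    · rw [hPhi]; exact EReal.coe_ne_top _
    · rw [hPhi]; exact EReal.coe_ne_bot _
    · rw [hPhi]
      simp only [hseq.Phi_eq hproblem hsurr]
      exact EReal.tendsto_coe.2 (hFlim.comp ((tendsto_add_atTop_nat 2).comp hψN))
    · refine squeeze_zero_norm (fun j => hw2 _ (hge j)) ?_
      simpa using ((hstep.comp hψN).add
        (hstep.comp ((tendsto_add_atTop_nat 1).comp hψN))).const_mul C
  refine ⟨xs, ?_, ?_, hcrit⟩
  swap
  · change BMME.Phi f g X xs ≠ ⊤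
    rw [hPhi]; exact EReal.coe_ne_top _
  obtain ⟨η, hη, U, hU, ξ, hconc, hnonneg, hsmoothξ, hcont, hzero, hpos, hineq⟩ :=
    hKL xs ⟨0, hcrit⟩
  -- restrict `ξ` to a compact interval `[0, R]` with `R < η`, since `η` may be infinite
  obtain ⟨R, hR0, hRη⟩ := EReal.lt_iff_exists_real_btwn.1 hη
  have hR : 0 < R := EReal.coe_pos.1 hR0
  obtain ⟨r, hr, hrU⟩ := Metric.mem_nhds_iff.1 hU
  have hlt : ∀ {s : ℝ}, s ≤ R → (s : EReal) < η := fun hs =>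
    (EReal.coe_le_coe_iff.2 hs).trans_lt hRη
  have hsub : Set.Icc 0 R ⊆ {s : ℝ | 0 ≤ s ∧ (s : EReal) < η} := fun s hs => ⟨hs.1, hlt hs.2⟩
  have hopen : IsOpen {s : ℝ | 0 < s ∧ (s : EReal) < η} :=
    (isOpen_lt continuous_const continuous_id).inter
      (isOpen_lt continuous_coe_real_ereal continuous_const)
  set M := max N₁ N₂ with hM
  have hshift : Tendsto (fun n => n + M) atTop atTop := tendsto_add_atTop_nat M
  refine (tendsto_add_atTop_iff_nat M).1 ?_
  refine BMME.tendsto_of_KL (y := fun n => x (n + M)) (F := fun n => BMME.objRe f g (x (n + M + 1)))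
    (H := fun n => BMME.lyapunov f g φ L δ x (n + M)) (Fs := Fs) (A := a) (b := C) (c := c) (r := r)
    (R := R) (ξ := ξ) (hconc.subset hsub (convex_Icc 0 R)) ?_ ?_ ?_ hzero (hcont.mono hsub)
    ha hC hc hr hR (hHlim.comp hshift) ?_ ?_ ?_ ?_ ?_ ?_
  · intro z hz
    exact (hsmoothξ.differentiableOn one_ne_zero).differentiableAt
      (hopen.mem_nhds ⟨hz.1, hlt hz.2.le⟩)
  · exact fun z hz => hpos z hz.1 (hlt hz.2.le)
  · exact fun z hz => hnonneg z hz.1 (hlt hz.2)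
  · intro n
    have h := hdec (n + M) (by omega)
    simpa only [add_right_comm] using h
  · exact fun n => (hFH (n + M) (by omega)).1
  · intro n
    have h := (hFH (n + M) (by omega)).2
    simpa only [add_right_comm] using h
  · have h := hstep.comp hshift
    simpa only [Function.comp_def, add_right_comm] using h
  · refine mapClusterPt_iff_frequently.2 fun s hs => frequently_atTop.2 fun n => ?_
    obtain ⟨j, hj, hjs⟩ := ((eventually_ge_atTop (n + M)).and (hψlim hs)).exists
    have h1 : n + M ≤ ψ j := hj.trans hψ.le_apply
    refine ⟨ψ j - M, by omega, ?_⟩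
    have h2 : ψ j - M + M = ψ j := by omega
    simp only [h2]
    exact hjs
  · intro n hball h1 h2
    obtain ⟨w, hw1, hw2⟩ := hw (n + M) (by omega)
    have hidx' : n + 2 + M = n + M + 2 := by omega
    have hidx'' : n + 1 + M = n + M + 1 := by omega
    simp only [hidx', hidx''] at hball h1 h2 ⊢
    have hval := hseq.Phi_eq hproblem hsurr (n + M)
    have hkl := hineq (x (n + M + 2)) (hrU hball)
      (by rw [hPhi, hval]; exact EReal.coe_lt_coe_iff.2 h1)
      (by
        rw [hPhi, hval]
        refine (EReal.coe_lt_coe_iff.2 h2).trans_le ?_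
        rw [EReal.coe_add]
        exact add_le_add le_rfl hRη.le) w hw1
    have hre : BMME.re (BMME.Phi f g X) (x (n + M + 2)) - BMME.re (BMME.Phi f g X) xs =
        BMME.objRe f g (x (n + M + 2)) - Fs := by
      simp only [BMME.re, hval, hPhi, EReal.toReal_coe]
    rw [hre] at hkl
    refine hkl.trans (mul_le_mul_of_nonneg_left hw2 (hpos _ (by linarith) (hlt (by linarith))).le)
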